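/- Let $N\ge 2$. Let $\mathcal D(\mathbb R^N)$ be the Hilbert space completion of $C_c^\infty(\mathbb R^N)^N$ (real vector fields) with respect to the norm $$\|u\|_{\mathcal D}=\Big(\int_{\mathbb R^N}|u|^2\,dx+\int_{\mathbb R^N}|u|^2|x|^2\,dx+\int_{\mathbb R^N}|\nabla u|^2\,dx\Big)^{1/2},\qquad |\nabla u|^2=\sum_{j,k=1}^N\Big(\frac{\partial u_j}{\partial x_k}\Big)^2,$$ regarded as a space of fields $u\in L^2(\mathbb R^N)^N$ (identified when equal almost everywhere) with weak gradient $\nabla u\in L^2$. A field $u\in\mathcal D(\mathbb R^N)$ is called toroidal if its radial component $\frac{x}{|x|}\cdot u$ and its divergence $\operatorname{div}u=\sum_k \partial u_k/\partial x_k$ both vanish (almost everywhere). (i) Every toroidal $u\in\mathcal D(\mathbb R^N)$ satisfies $$\int_{\mathbb R^N}|\nabla u|^2\,dx\int_{\mathbb R^N}|u|^2|x|^2\,dx\ \ge\ C_{T,N}\Big(\int_{\mathbb R^N}|u|^2\,dx\Big)^2,\qquad C_{T,N}=\frac{(N+2)^2}{4},$$ and the constant is best possible: $C_{T,N}$ is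 the minimum of the quotient $\int|\nabla u|^2dx\int|u|^2|x|^2dx\,\big/\,\big(\int|u|^2dx\big)^2$ over all toroidal $u\in\mathcal D(\mathbb R^N)\setminus\{0\}$. (ii) For every $c>0$ and all vectors $c_1,\dots,c_N\in\mathbb R^N$ such that the matrix $(c_1,\dots,c_N)$ is antisymmetric, the smooth field $$u_0(x)=(c_1\cdot x,\ \dots,\ c_N\cdot x)\,e^{-c|x|^2}$$ is a toroidal field in $\mathcal D(\mathbb R^N)$ for which equality holds in (i); it satisfies the decay condition in (iii), and it is nonzero unless $c_1=\dots=c_N=0$. (iii) Conversely, if $u\in\mathcal D(\mathbb R^N)\setminus\{0\}$ is a toroidal field for which equality holds in (i), and if $$\lim_{R\to\infty}R^N\int_{\mathbb S^{N-1}}|u(R\sigma)|^2\,d\sigma=0$$ (as an essential limit, i.e. disregarding a null set of radii $R$), then $u$ coincides almost everywhere with a field $u_0$ of the form in (ii). -/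

import Mathlib

open MeasureTheory Filter Topology
open scoped ENNReal ContDiff Matrix

noncomputable section

namespace HUP

/-- `ℝ^N` with its Euclidean norm. -/
abbrev Sp (N : ℕ) : Type := EuclideanSpace ℝ (Fin N)

/-- The classical Jacobian matrix `(∂u_j/∂x_k)_{j,k}`. -/
def jac {N : ℕ} (u : Sp N → Sp N) (x : Sp N) : Matrix (Fin N) (Fin N) ℝ :=
  fun j k => (fderiv ℝ u x (EuclideanSpace.single k 1)) j

/-- The square of the `𝒟`-distance between the pairs `(u, G)` and `(v, H)` of a vector field and a
matrix field (playing the role of its gradient):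
`∫ |u - v|² dx + ∫ |u - v|² |x|² dx + ∫ |G - H|² dx ∈ [0, ∞]`. -/
def distSqD {N : ℕ} (u : Sp N → Sp N) (G : Sp N → Matrix (Fin N) (Fin N) ℝ)
    (v : Sp N → Sp N) (H : Sp N → Matrix (Fin N) (Fin N) ℝ) : ℝ≥0∞ :=
  (∫⁻ x, ‖u x - v x‖ₑ ^ 2) + (∫⁻ x, ‖u x - v x‖ₑ ^ 2 * ‖x‖ₑ ^ 2)
    + ∫⁻ x, ∑ j, ∑ k, ‖G x j k - H x j k‖ₑ ^ 2

/-- `MemD u G`: the field `u` belongs to the completion `𝒟(ℝ^N)` of `C_c^∞(ℝ^N)^N` for the norm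
`(∫ |u|² + ∫ |u|²|x|² + ∫ |∇u|²)^{1/2}`, and `G` is its gradient `∇u` (with `G x j k = ∂u_j/∂x_k`),
that is, `(u, G)` is the limit of `(φ n, ∇(φ n))` for a sequence of test fields `φ n`.
Such a `G` is the weak gradient of `u`; it is determined by `u` up to a null set. -/
def MemD {N : ℕ} (u : Sp N → Sp N) (G : Sp N → Matrix (Fin N) (Fin N) ℝ) : Prop :=
  AEStronglyMeasurable u volume ∧
  (∀ j k, AEStronglyMeasurable (fun x => G x j k) volume) ∧
  ∃ φ : ℕ → Sp N → Sp N,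
    (∀ n, ContDiff ℝ ∞ (φ n) ∧ HasCompactSupport (φ n)) ∧
    Tendsto (fun n => distSqD (φ n) (jac (φ n)) u G) atTop (𝓝 0)

/-- The radial component `u_R = σ · u`, where `σ = x/|x|`. -/
def radial {N : ℕ} (u : Sp N → Sp N) (x : Sp N) : ℝ :=
  inner ℝ (‖x‖⁻¹ • x) (u x)

/-- The field `u` with gradient `G` is toroidal: `u_R = div u = 0` (almost everywhere). -/
def IsToroidal {N : ℕ} (u : Sp N → Sp N) (G : Sp N → Matrix (Fin N) (Fin N) ℝ) : Prop :=
  (∀ᵐ x, radial u x = 0) ∧ (∀ᵐ x, (G x).trace = 0)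

/-- `∫ |u|² dx` -/
def massInt {N : ℕ} (u : Sp N → Sp N) : ℝ := ∫ x, ‖u x‖ ^ 2

/-- `∫ |u|² |x|² dx` -/
def momentInt {N : ℕ} (u : Sp N → Sp N) : ℝ := ∫ x, ‖u x‖ ^ 2 * ‖x‖ ^ 2

/-- `∫ |∇u|² dx = ∫ ∑_{j,k} (∂u_j/∂x_k)² dx`, where `G = ∇u` -/
def gradInt {N : ℕ} (G : Sp N → Matrix (Fin N) (Fin N) ℝ) : ℝ :=
  ∫ x, ∑ j, ∑ k, G x j k ^ 2

/-- `lim_{R → ∞} R^N ∫_{S^{N-1}} |u(Rσ)|² dσ = 0`, with `dσ` the surface measure of the unit sphere.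
The limit is an essential one (null sets of radii `R` are disregarded), so that the condition
does not depend on the values of `u` on null sets; the ordinary limit implies it. -/
def DecayCond {N : ℕ} (u : Sp N → Sp N) : Prop :=
  Tendsto (fun R : ℝ => ENNReal.ofReal (R ^ N) *
      ∫⁻ s : Metric.sphere (0 : Sp N) 1, ‖u (R • (s : Sp N))‖ₑ ^ 2 ∂(volume : Measure (Sp N)).toSphere)
    (atTop ⊓ ae volume) (𝓝 0)

/-- The field `(c₁ · x, …, c_N · x) e^{-c|x|²}`, where `c_j` is the `j`-th row of `A`. -/
def profile {N : ℕ} (A : Matrix (Fin N) (Fin N) ℝ) (c : ℝ) (x : Sp N) : Sp N :=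
  WithLp.toLp 2 (fun j => (∑ k, A j k * x k) * Real.exp (-c * ‖x‖ ^ 2))

end HUP

end

/-! Let `m`, `M`, `g` stand for `massInt u`, `momentInt u`, `gradInt G`. For `b > 0` expand the sum
over `j, k` of `∫ ((∂_k + 2b x_k) u_j)²`. The cross terms are `∫ x_k u_j ∂_k u_j = -½ ∫ u_j²`, so
the sum equals `g + 4b² M - 2bN m`. The operators `∂_k + 2b x_k` are the lowering operators of a
harmonic oscillator with ground state `e^{-b|x|²}`.

The toroidal conditions enter through one observation: every component `u_j` is orthogonal to every
Gaussian `e^{-b|x|²}` (`integral_apply_mul_gauss_eq_zero`). Testing `div u = 0` against `x_j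
e^{-b|x|²}` gives `∫ u_j e^{-b|x|²}` plus a term containing `x · u`, which vanishes. The spectral
gap above the ground state (`SobD.gap`) therefore bounds the sum below by `4b m`, whence `g + 4b² M
≥ 2b(N+2) m` for all `b > 0` (`MemD.energy_ge`). Optimising in `b` gives the product inequality with
constant `(N+2)²/4`.

If equality holds, take `b` with `4b² M = g`. The gap is then attained by every component, so each
lies in the first excited eigenspace and is a linear form times `e^{-b|x|²}`
(`SobD.eq_linear_mul_gauss`). The condition `x · u = 0` makes the coefficient matrix antisymmetric.
Conversely such fields attain the gap (`SobD.gap_eq_of_lower_eq`).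

The gap is proved by expanding in Hermite functions. Their completeness comes from injectivity of
the Fourier transform on finite measures. -/

noncomputable section

namespace HUP

variable {N : ℕ} {b : ℝ}

/-! ### Functions with Gaussian decay -/

/-- `F` is dominated by `C e^{K|x| - b|x|²}` for some constants `C`, `K`. -/
def GaussDecay {E : Type*} [NormedAddCommGroup E] (b : ℝ) (F : Sp N → E) : Prop :=
  ∃ C K : ℝ, 0 ≤ C ∧ ∀ x, ‖F x‖ ≤ C * Real.exp (K * ‖x‖ - b * ‖x‖ ^ 2)

namespace GaussDecay

variable {E E' : Type*} [NormedAddCommGroup E] [NormedAddCommGroup E'] {b b' : ℝ}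

theorem mono {F : Sp N → E} {F' : Sp N → E'} (h : GaussDecay b F) (hF : ∀ x, ‖F' x‖ ≤ ‖F x‖) :
    GaussDecay b F' := by
  obtain ⟨C, K, hC, h⟩ := h
  exact ⟨C, K, hC, fun x => (hF x).trans (h x)⟩

theorem zero : GaussDecay b (fun _ : Sp N => (0 : E)) :=
  ⟨0, 0, le_rfl, fun x => by simp⟩

theorem add {F F' : Sp N → E} (h : GaussDecay b F) (h' : GaussDecay b F') :
    GaussDecay b (fun x => F x + F' x) := by
  obtain ⟨C, K, hC, h⟩ := h
  obtain ⟨C', K', hC', h'⟩ := h'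
  refine ⟨C + C', max K K', by positivity, fun x => ?_⟩
  refine (norm_add_le _ _).trans ?_
  rw [add_mul]
  refine add_le_add ((h x).trans ?_) ((h' x).trans ?_)
  · gcongr; exact le_max_left _ _
  · gcongr; exact le_max_right _ _

theorem sum {ι : Type*} {F : ι → Sp N → E} (s : Finset ι) (h : ∀ i ∈ s, GaussDecay b (F i)) :
    GaussDecay b (fun x => ∑ i ∈ s, F i x) := by
  classical
  induction s using Finset.induction_on with
  | empty => simpa using zero
  | insert i s hi ih =>
    simp only [Finset.sum_insert hi]
    exact (h i (by simp)).add (ih fun j hj => h j (by simp [hj]))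

theorem mul {F F' : Sp N → ℝ} (h : GaussDecay b F) (h' : GaussDecay b' F') :
    GaussDecay (b + b') (fun x => F x * F' x) := by
  obtain ⟨C, K, hC, h⟩ := h
  obtain ⟨C', K', hC', h'⟩ := h'
  refine ⟨C * C', K + K', by positivity, fun x => ?_⟩
  rw [norm_mul]
  calc ‖F x‖ * ‖F' x‖
      ≤ (C * Real.exp (K * ‖x‖ - b * ‖x‖ ^ 2)) * (C' * Real.exp (K' * ‖x‖ - b' * ‖x‖ ^ 2)) :=
        mul_le_mul (h x) (h' x) (norm_nonneg _) (by positivity)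
    _ = C * C' * (Real.exp (K * ‖x‖ - b * ‖x‖ ^ 2) * Real.exp (K' * ‖x‖ - b' * ‖x‖ ^ 2)) := by ring
    _ = _ := by rw [← Real.exp_add]; ring_nf

theorem const (a : E) : GaussDecay 0 (fun _ : Sp N => a) :=
  ⟨‖a‖, 0, norm_nonneg _, fun x => by simp⟩

/-- The bound `|x_k| ≤ |x| ≤ e^{|x|}` shows the role of the linear term in the exponent: it absorbs
polynomial factors without any loss in `b`. -/
theorem coord (k : Fin N) : GaussDecay 0 (fun x : Sp N => x k) := by
  refine ⟨1, 1, zero_le_one, fun x => ?_⟩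
  have h1 := PiLp.norm_apply_le x k
  have h2 := Real.add_one_le_exp ‖x‖
  simp only [one_mul, zero_mul, sub_zero]
  linarith

theorem const_mul {F : Sp N → ℝ} (a : ℝ) (h : GaussDecay b F) :
    GaussDecay b (fun x => a * F x) := by
  simpa using (const a).mul h

theorem coord_mul {F : Sp N → ℝ} (k : Fin N) (h : GaussDecay b F) :
    GaussDecay b (fun x => x k * F x) := by
  simpa using (coord k).mul h

theorem norm {F : Sp N → E} (h : GaussDecay b F) : GaussDecay b (fun x => ‖F x‖) :=
  h.mono fun x => by simp

theorem norm_pow (n : ℕ) : GaussDecay 0 (fun x : Sp N => ‖x‖ ^ n) := by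
  refine ⟨1, n, zero_le_one, fun x => ?_⟩
  have h2 : ‖x‖ ≤ Real.exp ‖x‖ := by linarith [Real.add_one_le_exp ‖x‖]
  simp only [one_mul, zero_mul, sub_zero, _root_.norm_pow, norm_norm, Real.exp_nat_mul]
  gcongr

theorem integrable {F : Sp N → E} (hb : 0 < b) (h : GaussDecay b F)
    (hF : AEStronglyMeasurable F volume) : Integrable F := by
  obtain ⟨C, K, hC, h⟩ := h
  have hg : Integrable (fun x : Sp N => Real.exp (-(b / 2) * ‖x‖ ^ 2)) := by
    have := (GaussianFourier.integrable_cexp_neg_mul_sq_norm_add (V := Sp N) (b := ((b / 2 : ℝ) : ℂ))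
      (by simpa using hb) 0 0).re
    refine this.congr (ae_of_all _ fun x => ?_)
    simp only [zero_mul, add_zero, RCLike.re_to_complex]
    rw [← Complex.ofReal_re (Real.exp _)]
    push_cast
    rfl
  -- Half of the quadratic decay absorbs the linear term: completing the square gives `Kr - br² ≤
  -- K²/(2b) - (b/2)r²`.
  refine (hg.const_mul (C * Real.exp (K ^ 2 / (2 * b)))).mono' hF (ae_of_all _ fun x => ?_)
  refine (h x).trans ?_
  rw [mul_assoc, ← Real.exp_add]
  gcongr
  have : K ^ 2 / (2 * b) + -(b / 2) * ‖x‖ ^ 2 - (K * ‖x‖ - b * ‖x‖ ^ 2)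
      = (K - b * ‖x‖) ^ 2 / (2 * b) := by field_simp; ring
  have : 0 ≤ (K - b * ‖x‖) ^ 2 / (2 * b) := by positivity
  linarith

theorem memLp {F : Sp N → E} (hb : 0 < b) (h : GaussDecay b F)
    (hF : AEStronglyMeasurable F volume) : MemLp F 2 := by
  rw [memLp_two_iff_integrable_sq_norm hF]
  have := (h.norm.mul h.norm).integrable (by positivity) (hF.norm.mul hF.norm)
  simpa only [pow_two] using this

end GaussDecay

/-! ### Hermite functions -/

/-- The Gaussian `e^{-b|x|²}`. -/
def gauss (b : ℝ) (x : Sp N) : ℝ := Real.exp (-b * ‖x‖ ^ 2)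

/-- The Hermite polynomials for the weight `e^{-2bt²}`. -/
def herm (b : ℝ) : ℕ → Polynomial ℝ
  | 0 => 1
  | n + 1 => Polynomial.C (4 * b) * Polynomial.X * herm b n - Polynomial.derivative (herm b n)

/-- The truncated `n - 1` is harmless at `n = 0`, where the factor `n` vanishes. The same applies to
each `α k - 1` below. -/
theorem derivative_herm (b : ℝ) (n : ℕ) :
    Polynomial.derivative (herm b n) = Polynomial.C (4 * b * n) * herm b (n - 1) := by
  induction n with
  | zero => simp [herm]
  | succ n ih =>
    rcases n with _ | n
    · simp [herm]
    · rw [herm, Polynomial.derivative_sub, Polynomial.derivative_mul, Polynomial.derivative_mul]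
      nth_rewrite 2 [ih]
      rw [ih]
      simp only [Nat.add_sub_cancel, Polynomial.derivative_mul, Polynomial.derivative_C,
        Polynomial.derivative_X, herm]
      push_cast
      simp only [map_add, map_mul, map_one]
      ring

/-- The Hermite function of multi-index `α`, not normalised. -/
def hermFun (b : ℝ) (α : Fin N → ℕ) (x : Sp N) : ℝ :=
  (∏ i, (herm b (α i)).eval (x i)) * gauss b x

theorem contDiff_gauss (b : ℝ) : ContDiff ℝ ∞ (gauss b : Sp N → ℝ) := by
  unfold gauss
  exact (contDiff_const.mul (contDiff_norm_sq ℝ)).exp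

theorem contDiff_coord (k : Fin N) : ContDiff ℝ ∞ (fun x : Sp N => x k) :=
  (EuclideanSpace.proj (𝕜 := ℝ) k : Sp N →L[ℝ] ℝ).contDiff

theorem contDiff_hermFun (b : ℝ) (α : Fin N → ℕ) : ContDiff ℝ ∞ (hermFun b α) := by
  unfold hermFun
  refine ContDiff.mul (contDiff_prod fun i _ => ?_) (contDiff_gauss b)
  have h : ContDiff ℝ ∞ (fun t : ℝ => (herm b (α i)).eval t) := by
    simpa using (herm b (α i)).contDiff_aeval (𝕜 := ℝ) (n := ∞)
  exact h.comp (contDiff_coord i)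

theorem gaussDecay_gauss (b : ℝ) : GaussDecay b (gauss b : Sp N → ℝ) :=
  ⟨1, 0, zero_le_one, fun x => by simp [gauss]⟩

theorem hermFun_zero (b : ℝ) : hermFun b (0 : Fin N → ℕ) = gauss b := by
  ext x; simp [hermFun, herm]

/-- Isolating the `k`-th factor lets one-variable Hermite identities lift to several variables; `α`
itself is treated as `Function.update α k (α k)`. -/
theorem hermFun_update (b : ℝ) (α : Fin N → ℕ) (k : Fin N) (m : ℕ) (x : Sp N) :
    hermFun b (Function.update α k m) x
      = (herm b m).eval (x k) * ((∏ i ∈ Finset.univ.erase k, (herm b (α i)).eval (x i)) * gauss b x) := by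
  rw [hermFun, ← Finset.mul_prod_erase _ _ (Finset.mem_univ k), mul_assoc]
  congr 2
  · simp
  · refine Finset.prod_congr rfl fun i hi => ?_
    rw [Function.update_of_ne (Finset.ne_of_mem_erase hi)]

/-- `4b x_k h_α = h_{α+e_k} + 4b α_k h_{α-e_k}` -/
theorem coord_mul_hermFun (b : ℝ) (α : Fin N → ℕ) (k : Fin N) (x : Sp N) :
    4 * b * (x k * hermFun b α x) = hermFun b (Function.update α k (α k + 1)) x
      + 4 * b * α k * hermFun b (Function.update α k (α k - 1)) x := by
  conv_lhs => rw [← Function.update_eq_self k α]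
  simp only [hermFun_update, herm, derivative_herm, Polynomial.eval_sub, Polynomial.eval_mul,
    Polynomial.eval_C, Polynomial.eval_X]
  ring

/-- `(∂_k + 2b x_k) h_α = 4b α_k h_{α-e_k}` -/
theorem fderiv_hermFun (b : ℝ) (α : Fin N → ℕ) (k : Fin N) (x : Sp N) :
    fderiv ℝ (hermFun b α) x (EuclideanSpace.single k 1) = 4 * b * α k *
      hermFun b (Function.update α k (α k - 1)) x - 2 * b * (x k * hermFun b α x) := by
  have hd : DifferentiableAt ℝ (hermFun b α) x :=
    ((contDiff_hermFun b α).differentiable (by simp)).differentiableAt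
  rw [← hd.lineDeriv_eq_fderiv, lineDeriv]
  have hg (t : ℝ) : gauss b (x + t • EuclideanSpace.single k (1 : ℝ))
      = Real.exp (-b * (‖x‖ ^ 2 + 2 * t * x k + t ^ 2)) := by
    have : ‖x + t • EuclideanSpace.single k (1 : ℝ)‖ ^ 2 = ‖x‖ ^ 2 + 2 * t * x k + t ^ 2 := by
      rw [norm_add_sq_real, norm_smul, real_inner_smul_right, EuclideanSpace.inner_single_right]
      simp
      ring
    rw [gauss, this]
  have hfun : (fun t : ℝ => hermFun b α (x + t • EuclideanSpace.single k (1 : ℝ))) = fun t : ℝ =>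
      (herm b (α k)).eval (x k + t) * ((∏ i ∈ Finset.univ.erase k, (herm b (α i)).eval (x i)) *
        Real.exp (-b * (‖x‖ ^ 2 + 2 * t * x k + t ^ 2))) := by
    funext t
    conv_lhs => rw [← Function.update_eq_self k α]
    rw [hermFun_update, hg]
    congr 2
    · simp
    · refine Finset.prod_congr rfl fun i hi => ?_
      simp [Finset.ne_of_mem_erase hi]
  rw [hfun]
  have h1 : HasDerivAt (fun t : ℝ => (herm b (α k)).eval (x k + t))
      ((Polynomial.derivative (herm b (α k))).eval (x k + 0)) 0 :=
    HasDerivAt.comp_const_add (x k) 0 ((herm b (α k)).hasDerivAt (x k + 0))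
  have h2 : HasDerivAt (fun t : ℝ => -b * (‖x‖ ^ 2 + 2 * t * x k + t ^ 2)) (-b * (2 * x k)) 0 := by
    have : HasDerivAt (fun t : ℝ => ‖x‖ ^ 2 + 2 * t * x k + t ^ 2)
        (2 * 1 * x k + 2 * (0 : ℝ) ^ (2 - 1) * 1) 0 := by
      exact ((((hasDerivAt_id (0 : ℝ)).const_mul 2).mul_const (x k)).const_add (‖x‖ ^ 2)).fun_add
        ((hasDerivAt_id (0 : ℝ)).fun_pow 2)
    simpa using this.const_mul (-b)
  rw [(h1.fun_mul (h2.exp.const_mul _)).deriv]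
  conv_rhs => rw [← Function.update_eq_self k α]
  simp only [hermFun_update, derivative_herm, Polynomial.eval_mul, Polynomial.eval_C, gauss,
    Function.update_self, Function.update_idem]
  simp
  ring

theorem gaussDecay_hermFun (b : ℝ) (α : Fin N → ℕ) : GaussDecay b (hermFun b α) := by
  have key (p : Polynomial ℝ) (i : Fin N) : GaussDecay 0 (fun x : Sp N => p.eval (x i)) := by
    induction p using Polynomial.induction_on' with
    | add p q hp hq => simpa using hp.add hq
    | monomial n a =>
      simp only [Polynomial.eval_monomial]
      refine GaussDecay.const_mul a ?_
      induction n with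
      | zero => simpa using GaussDecay.const (1 : ℝ)
      | succ n ih => simpa [pow_succ'] using ih.coord_mul i
  have hp (s : Finset (Fin N)) :
      GaussDecay 0 (fun x : Sp N => ∏ i ∈ s, (herm b (α i)).eval (x i)) := by
    induction s using Finset.induction_on with
    | empty => simpa using GaussDecay.const (1 : ℝ)
    | insert i s hi ih =>
      simp only [Finset.prod_insert hi]
      simpa using (key _ i).mul ih
  have := (hp Finset.univ).mul (gaussDecay_gauss b)
  rwa [zero_add] at this

/-- `h_{α+e_k} = (-∂_k + 2b x_k) h_α` -/
theorem hermFun_update_succ (b : ℝ) (α : Fin N → ℕ) (k : Fin N) (x : Sp N) :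
    hermFun b (Function.update α k (α k + 1)) x = 2 * b * (x k * hermFun b α x)
      - fderiv ℝ (hermFun b α) x (EuclideanSpace.single k 1) := by
  rw [fderiv_hermFun]
  linarith [coord_mul_hermFun b α k x]

theorem differentiable_hermFun (b : ℝ) (α : Fin N → ℕ) : Differentiable ℝ (hermFun b α) :=
  (contDiff_hermFun b α).differentiable (by simp)

theorem continuous_hermFun (b : ℝ) (α : Fin N → ℕ) : Continuous (hermFun b α) :=
  (contDiff_hermFun b α).continuous

theorem continuous_gauss (b : ℝ) : Continuous (gauss b : Sp N → ℝ) := (contDiff_gauss b).continuous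

theorem gauss_pos (b : ℝ) (x : Sp N) : 0 < gauss b x := Real.exp_pos _

theorem continuous_fderiv_apply {F : Sp N → ℝ} (hF : ContDiff ℝ ∞ F) (v : Sp N) :
    Continuous fun x => fderiv ℝ F x v :=
  (hF.continuous_fderiv (by simp)).clm_apply continuous_const

theorem gaussDecay_fderiv_hermFun (b : ℝ) (α : Fin N → ℕ) (k : Fin N) :
    GaussDecay b (fun x => fderiv ℝ (hermFun b α) x (EuclideanSpace.single k 1)) := by
  have h := ((gaussDecay_hermFun b (Function.update α k (α k - 1))).const_mul (4 * b * α k)).add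
    (((gaussDecay_hermFun b α).coord_mul k).const_mul (-(2 * b)))
  refine h.mono fun x => le_of_eq ?_
  rw [fderiv_hermFun]
  ring_nf

theorem memLp_hermFun (hb : 0 < b) (α : Fin N → ℕ) : MemLp (hermFun b α) 2 :=
  (gaussDecay_hermFun b α).memLp hb (continuous_hermFun b α).aestronglyMeasurable

/-! ### Orthogonality and norms of the Hermite functions in `L²`. -/

theorem inner_toLp_eq_integral {f g : Sp N → ℝ} (hf : MemLp f 2) (hg : MemLp g 2) :
    inner ℝ (hf.toLp f) (hg.toLp g) = ∫ x, f x * g x := by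
  rw [L2.inner_def]
  refine integral_congr_ae ?_
  filter_upwards [hf.coeFn_toLp, hg.coeFn_toLp] with x h1 h2
  simp [h1, h2, mul_comm]

theorem norm_sq_toLp_eq_integral {f : Sp N → ℝ} (hf : MemLp f 2) :
    ‖hf.toLp f‖ ^ 2 = ∫ x, f x ^ 2 := by
  rw [← real_inner_self_eq_norm_sq, inner_toLp_eq_integral]
  simp only [pow_two]

/-- The raising operator `-∂_k + 2b x_k` is the adjoint of the lowering operator `∂_k + 2b x_k`, by
an integration by parts that Gaussian decay justifies. -/
theorem integral_hermFun_succ_mul (hb : 0 < b) (α β : Fin N → ℕ) (k : Fin N) :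
    ∫ x, hermFun b (Function.update α k (α k + 1)) x * hermFun b β x
      = 4 * b * β k * ∫ x, hermFun b α x * hermFun b (Function.update β k (β k - 1)) x := by
  have c1 := continuous_hermFun b α
  have c2 := continuous_hermFun b β
  have c3 := continuous_fderiv_apply (contDiff_hermFun b α) (EuclideanSpace.single k 1)
  have c4 := continuous_fderiv_apply (contDiff_hermFun b β) (EuclideanSpace.single k 1)
  have d1 := gaussDecay_hermFun b α
  have d2 := gaussDecay_hermFun b β
  have d3 := gaussDecay_fderiv_hermFun b α k
  have d4 := gaussDecay_fderiv_hermFun b β k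
  have hbb : 0 < b + b := by positivity
  have i1 := (d3.mul d2).integrable hbb (c3.mul c2).aestronglyMeasurable
  have i2 := (d1.mul d4).integrable hbb (c1.mul c4).aestronglyMeasurable
  have i3 := (d1.mul d2).integrable hbb (c1.mul c2).aestronglyMeasurable
  have i4 := ((d1.mul d2).coord_mul k).integrable hbb
    ((contDiff_coord k).continuous.mul (c1.mul c2)).aestronglyMeasurable
  have ibp := integral_mul_fderiv_eq_neg_fderiv_mul_of_integrable (μ := volume) i1 i2 i3
    (fun x _ => differentiable_hermFun b α x) (fun x _ => differentiable_hermFun b β x)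
  rw [← integral_const_mul]
  calc ∫ x, hermFun b (Function.update α k (α k + 1)) x * hermFun b β x
      = ∫ x, (2 * b * (x k * (hermFun b α x * hermFun b β x))
          - fderiv ℝ (hermFun b α) x (EuclideanSpace.single k 1) * hermFun b β x) := by
        simp only [hermFun_update_succ]
        congr 1; ext x; ring
    _ = ∫ x, (2 * b * (x k * (hermFun b α x * hermFun b β x))
          + hermFun b α x * fderiv ℝ (hermFun b β) x (EuclideanSpace.single k 1)) := by
        rw [integral_sub (i4.const_mul _) i1, integral_add (i4.const_mul _) i2, ibp, sub_eq_add_neg]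
    _ = _ := by
        simp only [fderiv_hermFun]
        congr 1; ext x; ring

theorem update_pred_succ (α : Fin N → ℕ) (k : Fin N) (h : α k ≠ 0) :
    Function.update (Function.update α k (α k - 1)) k
      ((Function.update α k (α k - 1)) k + 1) = α := by
  rw [Function.update_self, Function.update_idem, Nat.sub_add_cancel (Nat.pos_of_ne_zero h),
    Function.update_eq_self]

/-- Each raising operator taken off `β` lowers `α`. As `α k` is the smaller index, it reaches zero
first, and one more lowering annihilates the function. -/
theorem integral_hermFun_mul_of_lt (hb : 0 < b) {α β : Fin N → ℕ} {k : Fin N} (h : α k < β k) :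
    ∫ x, hermFun b β x * hermFun b α x = 0 := by
  induction hn : α k generalizing α β with
  | zero =>
    rw [← update_pred_succ β k (by omega), integral_hermFun_succ_mul hb, hn]
    simp
  | succ n ih =>
    rw [← update_pred_succ β k (by omega), integral_hermFun_succ_mul hb]
    rw [ih (by simp; omega) (by simp [hn]), mul_zero]

theorem integral_hermFun_mul_of_ne (hb : 0 < b) {α β : Fin N → ℕ} (h : α ≠ β) :
    ∫ x, hermFun b α x * hermFun b β x = 0 := by
  obtain ⟨k, hk⟩ := Function.ne_iff.1 h
  rcases lt_or_gt_of_ne hk with hk | hk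
  · simpa only [mul_comm] using integral_hermFun_mul_of_lt hb hk
  · exact integral_hermFun_mul_of_lt hb hk

/-- The Hermite functions as elements of `L²`. -/
def hermLp (hb : 0 < b) (α : Fin N → ℕ) : Lp ℝ 2 (volume : Measure (Sp N)) :=
  (memLp_hermFun hb α).toLp

theorem norm_sq_hermLp_succ (hb : 0 < b) (α : Fin N → ℕ) (k : Fin N) :
    ‖hermLp hb (Function.update α k (α k + 1))‖ ^ 2 = 4 * b * (α k + 1) * ‖hermLp hb α‖ ^ 2 := by
  rw [hermLp, hermLp, ← real_inner_self_eq_norm_sq, ← real_inner_self_eq_norm_sq,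
    inner_toLp_eq_integral, inner_toLp_eq_integral, integral_hermFun_succ_mul hb]
  simp

/-- Induction on the total degree: the Gaussian is nowhere zero, and raising multiplies the squared
norm by a positive factor. -/
theorem norm_hermLp_pos (hb : 0 < b) (α : Fin N → ℕ) : 0 < ‖hermLp hb α‖ := by
  rw [norm_pos_iff]
  induction hn : ∑ i, α i generalizing α with
  | zero =>
    have : α = 0 := by
      ext i; simpa using (Finset.sum_eq_zero_iff.1 hn) i (Finset.mem_univ i)
    subst this
    intro h
    have h1 := (memLp_hermFun hb (0 : Fin N → ℕ)).coeFn_toLp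
    obtain ⟨x, hx, hx'⟩ := (h1.and ((Lp.eq_zero_iff_ae_eq_zero).1 h)).exists
    have h2 : hermFun b 0 x = 0 := hx.symm.trans hx'
    rw [hermFun_zero] at h2
    exact (gauss_pos b x).ne' h2
  | succ n ih =>
    have : ∃ k, α k ≠ 0 := by
      by_contra! h
      simp [h] at hn
    obtain ⟨k, hk⟩ := this
    have hs : ∑ i, Function.update α k (α k - 1) i = n := by
      rw [Finset.sum_update_of_mem (Finset.mem_univ k)]
      rw [← Finset.add_sum_erase _ _ (Finset.mem_univ k), ← Finset.sdiff_singleton_eq_erase] at hn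
      omega
    have h0 := norm_pos_iff.2 (ih _ hs)
    have h := norm_sq_hermLp_succ hb (Function.update α k (α k - 1)) k
    rw [update_pred_succ α k hk] at h
    intro hz
    rw [hz, norm_zero] at h
    have : (0 : ℝ) < 4 * b * ((Function.update α k (α k - 1) k : ℕ) + 1)
      * ‖hermLp hb (Function.update α k (α k - 1))‖ ^ 2 := by positivity
    rw [← h] at this
    norm_num at this

/-- The normalised Hermite functions. -/
def hermUnit (hb : 0 < b) (α : Fin N → ℕ) : Lp ℝ 2 (volume : Measure (Sp N)) :=
  ‖hermLp hb α‖⁻¹ • hermLp hb α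

theorem orthonormal_hermUnit (hb : 0 < b) : Orthonormal ℝ (hermUnit (N := N) hb) := by
  constructor
  · intro α
    rw [hermUnit, norm_smul, norm_inv, norm_norm, inv_mul_cancel₀ (norm_hermLp_pos hb α).ne']
  · intro α β h
    rw [hermUnit, hermUnit, real_inner_smul_left, real_inner_smul_right, hermLp, hermLp,
      inner_toLp_eq_integral, integral_hermFun_mul_of_ne hb h]
    simp

/-! ### Completeness of the Hermite functions. -/

/-- The linear forms act on the span of the Hermite functions by multiplication. -/
theorem inner_mul_mem_span_hermFun (hb : 0 < b) (t : Sp N) {F : Sp N → ℝ}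
    (hF : F ∈ Submodule.span ℝ (Set.range (hermFun (N := N) b))) :
    (fun x => inner ℝ x t * F x) ∈ Submodule.span ℝ (Set.range (hermFun (N := N) b)) := by
  induction hF using Submodule.span_induction with
  | mem F hF =>
    obtain ⟨α, rfl⟩ := hF
    have : (fun x => inner ℝ x t * hermFun b α x) = ∑ k, (t k / (4 * b)) •
        (hermFun b (Function.update α k (α k + 1))
          + (4 * b * α k) • hermFun b (Function.update α k (α k - 1))) := by
      ext x
      simp only [Finset.sum_apply, Pi.smul_apply, Pi.add_apply, smul_eq_mul, ← coord_mul_hermFun,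
        PiLp.inner_apply, Finset.sum_mul]
      refine Finset.sum_congr rfl fun k _ => ?_
      simp
      field_simp
    rw [this]
    refine Submodule.sum_mem _ fun k _ => Submodule.smul_mem _ _ (Submodule.add_mem _ ?_
      (Submodule.smul_mem _ _ ?_))
    · exact Submodule.subset_span ⟨_, rfl⟩
    · exact Submodule.subset_span ⟨_, rfl⟩
  | zero =>
    simp only [Pi.zero_apply, mul_zero]
    exact Submodule.zero_mem _
  | add F F' _ _ h h' =>
    simp only [Pi.add_apply, mul_add]
    exact Submodule.add_mem _ h h'
  | smul a F _ h =>
    convert Submodule.smul_mem _ a h using 1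
    ext x
    simp
    ring

theorem inner_pow_mul_gauss_mem_span_hermFun (hb : 0 < b) (t : Sp N) (n : ℕ) :
    (fun x => inner ℝ x t ^ n * gauss b x) ∈ Submodule.span ℝ (Set.range (hermFun (N := N) b)) := by
  induction n with
  | zero =>
    refine Submodule.subset_span ⟨0, ?_⟩
    rw [hermFun_zero]
    simp
  | succ n ih =>
    convert inner_mul_mem_span_hermFun hb t ih using 2
    rw [pow_succ', mul_assoc]

theorem integral_mul_inner_pow_mul_gauss_eq_zero (hb : 0 < b) {f : Sp N → ℝ} (hf : MemLp f 2)
    (h : ∀ α, ∫ x, f x * hermFun b α x = 0) (t : Sp N) (n : ℕ) :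
    ∫ x, f x * (inner ℝ x t ^ n * gauss b x) = 0 := by
  have key : ∀ F ∈ Submodule.span ℝ (Set.range (hermFun (N := N) b)),
      Integrable (fun x => f x * F x) ∧ ∫ x, f x * F x = 0 := by
    intro F hF
    induction hF using Submodule.span_induction with
    | mem F hF =>
      obtain ⟨α, rfl⟩ := hF
      exact ⟨hf.integrable_mul (memLp_hermFun hb α), h α⟩
    | zero => simp
    | add F F' _ _ h h' =>
      simp only [Pi.add_apply, mul_add]
      exact ⟨h.1.add h'.1, by rw [integral_add h.1 h'.1, h.2, h'.2, add_zero]⟩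
    | smul a F _ h =>
      simp only [Pi.smul_apply, smul_eq_mul, mul_left_comm _ a]
      exact ⟨h.1.const_mul a, by rw [integral_const_mul, h.2, mul_zero]⟩
  exact (key _ (inner_pow_mul_gauss_mem_span_hermFun hb t n)).2

/-- An integrable function with vanishing Fourier transform vanishes almost everywhere. -/
theorem ae_eq_zero_of_integral_cexp_eq_zero {f : Sp N → ℝ} (hf : Integrable f)
    (h : ∀ t : Sp N, ∫ x, (f x : ℂ) * Complex.exp (inner ℝ x t * Complex.I) = 0) :
    f =ᵐ[volume] 0 := by
  -- Since `ENNReal.ofReal` truncates at zero, `μ f` and `μ (-f)` have the positive and negative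
  -- parts of `f` as densities. These finite measures have equal characteristic functions, hence
  -- coincide.
  let μ (g : Sp N → ℝ) : Measure (Sp N) := volume.withDensity fun x => ENNReal.ofReal (g x)
  have hchar {g : Sp N → ℝ} (hg : Integrable g) (t : Sp N) : charFun (μ g) t
      = ∫ x, ((max (g x) 0 : ℝ) : ℂ) * Complex.exp (inner ℝ x t * Complex.I) := by
    rw [charFun_apply, integral_withDensity_eq_integral_toReal_smul₀ hg.1.aemeasurable.ennreal_ofReal
      (ae_of_all _ fun _ => ENNReal.ofReal_lt_top)]
    refine integral_congr_ae (ae_of_all _ fun x => ?_)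
    simp only [ENNReal.toReal_ofReal', Complex.real_smul]
  have hfin {g : Sp N → ℝ} (hg : Integrable g) : IsFiniteMeasure (μ g) :=
    isFiniteMeasure_withDensity_ofReal hg.2
  have hint {g : Sp N → ℝ} (hg : Integrable g) (t : Sp N) : Integrable
      fun x => (g x : ℂ) * Complex.exp (inner ℝ x t * Complex.I) := by
    refine hg.norm.mono' ?_ (ae_of_all _ fun x => ?_)
    · refine (Complex.continuous_ofReal.comp_aestronglyMeasurable hg.1).mul
        (Continuous.aestronglyMeasurable ?_)
      fun_prop
    · rw [norm_mul, Complex.norm_exp_ofReal_mul_I]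
      simp
  have := hfin hf
  have := hfin hf.neg
  have heq : μ f = μ (-f) := by
    refine Measure.ext_of_charFun (funext fun t => ?_)
    rw [hchar hf, hchar hf.neg, ← sub_eq_zero, ← integral_sub (hint hf.pos_part t)
      (hint hf.neg.pos_part t), ← h t]
    refine integral_congr_ae (ae_of_all _ fun x => ?_)
    simp only [Pi.neg_apply]
    rw [← sub_mul, ← Complex.ofReal_sub]
    congr 2
    rcases le_total (f x) 0 with hx | hx
    · rw [max_eq_right hx, max_eq_left (by linarith)]; ring
    · rw [max_eq_left hx, max_eq_right (by linarith)]; ring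
  have hae := (withDensity_eq_iff hf.1.aemeasurable.ennreal_ofReal
    hf.neg.1.aemeasurable.ennreal_ofReal (by
      have := measure_lt_top (μ f) Set.univ
      simp only [μ, withDensity_apply _ MeasurableSet.univ, Measure.restrict_univ] at this
      exact this.ne)).1 heq
  filter_upwards [hae] with x hx
  simp only [Pi.neg_apply, Pi.zero_apply] at hx ⊢
  have := congrArg ENNReal.toReal hx
  rw [ENNReal.toReal_ofReal', ENNReal.toReal_ofReal'] at this
  rcases le_total (f x) 0 with hx | hx
  · rw [max_eq_right hx, max_eq_left (by linarith)] at this; linarith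
  · rw [max_eq_left hx, max_eq_right (by linarith)] at this; linarith

theorem gaussDecay_gauss_mul_exp_inner (b : ℝ) (t : Sp N) :
    GaussDecay b fun x : Sp N => gauss b x * Real.exp |inner ℝ x t| := by
  refine ⟨1, ‖t‖, zero_le_one, fun x => ?_⟩
  simp only [gauss]
  rw [← Real.exp_add, Real.norm_of_nonneg (Real.exp_nonneg _), one_mul]
  gcongr
  linarith [abs_real_inner_le_norm x t, mul_comm ‖x‖ ‖t‖]

theorem memLp_gauss (hb : 0 < b) : MemLp (gauss b : Sp N → ℝ) 2 :=
  (gaussDecay_gauss b).memLp hb (continuous_gauss b).aestronglyMeasurable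

theorem hasSum_cexp_series (z : ℂ) : HasSum (fun n : ℕ => z ^ n / n.factorial) (Complex.exp z) := by
  rw [Complex.exp_eq_exp_ℂ]
  exact NormedSpace.expSeries_div_hasSum_exp _

theorem hasSum_rexp_series (z : ℝ) : HasSum (fun n : ℕ => z ^ n / n.factorial) (Real.exp z) := by
  rw [Real.exp_eq_exp_ℝ]
  exact NormedSpace.expSeries_div_hasSum_exp _

/-- Expansion of a Fourier integral into moments. -/
theorem hasSum_integral_mul_cexp {f : Sp N → ℝ} (hf : AEStronglyMeasurable f volume) (t : Sp N)
    (h : Integrable fun x => |f x| * Real.exp |inner ℝ x t|) :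
    HasSum (fun n : ℕ => ∫ x, (f x : ℂ) * ((inner ℝ x t * Complex.I) ^ n / n.factorial))
      (∫ x, (f x : ℂ) * Complex.exp (inner ℝ x t * Complex.I)) := by
  refine hasSum_integral_of_dominated_convergence
    (fun n x => |f x| * (|inner ℝ x t| ^ n / n.factorial)) (fun n => ?_)
    (fun n => ae_of_all _ fun x => ?_) (ae_of_all _ fun x => ?_) ?_ (ae_of_all _ fun x => ?_)
  · refine (Complex.continuous_ofReal.comp_aestronglyMeasurable hf).mul
      (Continuous.aestronglyMeasurable ?_)
    fun_prop
  · simp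
  · exact (hasSum_rexp_series _).summable.mul_left _
  · refine h.congr (ae_of_all _ fun x => ?_)
    simp only
    rw [tsum_mul_left, (hasSum_rexp_series _).tsum_eq]
  · exact (hasSum_cexp_series _).mul_left _

/-- Completeness of the Hermite functions. -/
theorem ae_eq_zero_of_integral_mul_hermFun_eq_zero (hb : 0 < b) {f : Sp N → ℝ} (hf : MemLp f 2)
    (h : ∀ α, ∫ x, f x * hermFun b α x = 0) : f =ᵐ[volume] 0 := by
  have hfg : Integrable (fun x => f x * gauss b x) := hf.integrable_mul (memLp_gauss hb)
  -- The factor `gauss b` makes the function integrable even against `e^{|x · t|}`, so its Fourier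
  -- transform is the sum of its moment series.
  suffices (fun x => f x * gauss b x) =ᵐ[volume] 0 by
    filter_upwards [this] with x hx
    exact (mul_eq_zero.1 hx).resolve_right (gauss_pos b x).ne'
  refine ae_eq_zero_of_integral_cexp_eq_zero hfg fun t => ?_
  have hbound : Integrable (fun x => |f x * gauss b x| * Real.exp |inner ℝ x t|) := by
    have hc : Continuous fun x : Sp N => gauss b x * Real.exp |inner ℝ x t| :=
      (continuous_gauss b).mul (by fun_prop)
    have := hf.norm.integrable_mul
      ((gaussDecay_gauss_mul_exp_inner b t).memLp hb hc.aestronglyMeasurable)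
    refine this.congr (ae_of_all _ fun x => ?_)
    simp only [Pi.mul_apply, abs_mul, abs_of_pos (gauss_pos b x), Real.norm_eq_abs, mul_assoc]
  have hsum := hasSum_integral_mul_cexp hfg.1 t hbound
  have h0 (n : ℕ) : ∫ x, ((f x * gauss b x : ℝ) : ℂ) *
      (((inner ℝ x t : ℝ) * Complex.I) ^ n / n.factorial) = 0 := by
    have (x : Sp N) : ((f x * gauss b x : ℝ) : ℂ) *
        (((inner ℝ x t : ℝ) * Complex.I) ^ n / n.factorial)
        = (Complex.I ^ n / n.factorial) * ((f x * (inner ℝ x t ^ n * gauss b x) : ℝ) : ℂ) := by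
      push_cast; ring
    simp only [this]
    rw [integral_const_mul, integral_complex_ofReal,
      integral_mul_inner_pow_mul_gauss_eq_zero hb hf h t n]
    simp
  simp only [h0] at hsum
  exact hsum.unique hasSum_zero

/-- The Hilbert basis of normalised Hermite functions. -/
def hermBasis (hb : 0 < b) : HilbertBasis (Fin N → ℕ) ℝ (Lp ℝ 2 (volume : Measure (Sp N))) :=
  HilbertBasis.mkOfOrthogonalEqBot (orthonormal_hermUnit hb) (by
    rw [Submodule.eq_bot_iff]
    intro f hf
    rw [Submodule.mem_orthogonal] at hf
    have hf2 : MemLp f 2 := Lp.memLp f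
    have h0 : (f : Sp N → ℝ) =ᵐ[volume] 0 := by
      refine ae_eq_zero_of_integral_mul_hermFun_eq_zero hb hf2 fun α => ?_
      have h := hf _ (Submodule.subset_span ⟨α, rfl⟩)
      rw [hermUnit, real_inner_smul_left, mul_eq_zero, inv_eq_zero] at h
      have h := h.resolve_left (norm_hermLp_pos hb α).ne'
      rw [hermLp, ← Lp.toLp_coeFn f hf2, inner_toLp_eq_integral] at h
      simpa only [mul_comm] using h
    exact (Lp.eq_zero_iff_ae_eq_zero).2 h0)

theorem hermBasis_apply (hb : 0 < b) (α : Fin N → ℕ) : hermBasis hb α = hermUnit hb α := by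
  rw [hermBasis, HilbertBasis.coe_mkOfOrthogonalEqBot]

theorem integrable_mul_of_memLp {f g : Sp N → ℝ} (hf : MemLp f 2) (hg : MemLp g 2) :
    Integrable fun x => f x * g x :=
  hf.integrable_mul hg

/-! ### The scalar weighted Sobolev space -/

/-- Carries the bilinear integral identities from test functions to their limits. -/
theorem tendsto_integral_mul {f g : Sp N → ℝ} {φ ψ : ℕ → Sp N → ℝ} (hf : MemLp f 2)
    (hg : MemLp g 2) (hφ : ∀ n, MemLp (φ n) 2) (hψ : ∀ n, MemLp (ψ n) 2)
    (h : Tendsto (fun n => eLpNorm (φ n - f) 2 volume) atTop (𝓝 0))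
    (h' : Tendsto (fun n => eLpNorm (ψ n - g) 2 volume) atTop (𝓝 0)) :
    Tendsto (fun n => ∫ x, φ n x * ψ n x) atTop (𝓝 (∫ x, f x * g x)) := by
  simp only [← inner_toLp_eq_integral hf hg, ← fun n => inner_toLp_eq_integral (hφ n) (hψ n)]
  exact ((Lp.tendsto_Lp_iff_tendsto_eLpNorm'' φ hφ f hf).2 h).inner
    ((Lp.tendsto_Lp_iff_tendsto_eLpNorm'' ψ hψ g hg).2 h')

/-- `f` is the limit of test functions for the norm `(∫ |f|² + ∫ |f|²|x|² + ∫ |∇f|²)^{1/2}`, and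
`g` is its gradient. -/
structure SobD (f : Sp N → ℝ) (g : Fin N → Sp N → ℝ) : Prop where
  memLp : MemLp f 2
  memLp_coord : ∀ k, MemLp (fun x => x k * f x) 2
  memLp_grad : ∀ k, MemLp (g k) 2
  exists_approx : ∃ φ : ℕ → Sp N → ℝ, (∀ n, ContDiff ℝ ∞ (φ n) ∧ HasCompactSupport (φ n)) ∧
    Tendsto (fun n => eLpNorm (φ n - f) 2 volume) atTop (𝓝 0) ∧
    (∀ k, Tendsto (fun n => eLpNorm ((fun x => x k * φ n x) - (fun x => x k * f x)) 2 volume)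
      atTop (𝓝 0)) ∧
    (∀ k, Tendsto (fun n => eLpNorm
      ((fun x => fderiv ℝ (φ n) x (EuclideanSpace.single k 1)) - g k) 2 volume) atTop (𝓝 0))

theorem memLp_of_contDiff_of_hasCompactSupport {φ : Sp N → ℝ} (h : ContDiff ℝ ∞ φ)
    (h' : HasCompactSupport φ) : MemLp φ 2 :=
  h.continuous.memLp_of_hasCompactSupport h'

theorem memLp_coord_mul {φ : Sp N → ℝ} (h : ContDiff ℝ ∞ φ)
    (h' : HasCompactSupport φ) (k : Fin N) : MemLp (fun x => x k * φ x) 2 :=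
  memLp_of_contDiff_of_hasCompactSupport ((contDiff_coord k).mul h) h'.mul_left

theorem memLp_fderiv_apply {φ : Sp N → ℝ} (h : ContDiff ℝ ∞ φ)
    (h' : HasCompactSupport φ) (v : Sp N) : MemLp (fun x => fderiv ℝ φ x v) 2 :=
  (continuous_fderiv_apply h v).memLp_of_hasCompactSupport (h'.fderiv_apply ℝ v)

theorem fderiv_coord_mul {φ : Sp N → ℝ} (h : Differentiable ℝ φ) (k l : Fin N) (x : Sp N) :
    fderiv ℝ (fun x : Sp N => x k * φ x) x (EuclideanSpace.single l 1)
      = (if k = l then φ x else 0) + x k * fderiv ℝ φ x (EuclideanSpace.single l 1) := by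
  have h1 : HasFDerivAt (fun x : Sp N => x k) (EuclideanSpace.proj (𝕜 := ℝ) k : Sp N →L[ℝ] ℝ) x :=
    (EuclideanSpace.proj (𝕜 := ℝ) k : Sp N →L[ℝ] ℝ).hasFDerivAt
  rw [(h1.fun_mul (h x).hasFDerivAt).fderiv]
  by_cases hkl : k = l <;> simp [hkl]
  all_goals ring

/-- Integration by parts reproduces the integral with opposite sign, up to `∫ φ²` from `∂_k x_k =
1`; hence the factor one half. -/
theorem integral_coord_mul_mul_fderiv {φ : Sp N → ℝ} (h : ContDiff ℝ ∞ φ)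
    (h' : HasCompactSupport φ) (k : Fin N) :
    ∫ x, (x k * φ x) * fderiv ℝ φ x (EuclideanSpace.single k 1) = -(1 / 2) * ∫ x, φ x * φ x := by
  have hd := h.differentiable (by simp)
  have m1 := memLp_of_contDiff_of_hasCompactSupport h h'
  have m2 := memLp_coord_mul h h' k
  have m3 := memLp_fderiv_apply h h' (EuclideanSpace.single k 1)
  have m4 := memLp_fderiv_apply ((contDiff_coord k).mul h) h'.mul_left (EuclideanSpace.single k 1)
  have ibp := integral_mul_fderiv_eq_neg_fderiv_mul_of_integrable (μ := volume)
    (f := fun x : Sp N => x k * φ x) (g := φ) (v := EuclideanSpace.single k 1)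
    (m4.integrable_mul m1) (m2.integrable_mul m3) (m2.integrable_mul m1)
    (fun x _ => (((contDiff_coord k).mul h).differentiable (by simp)) x) (fun x _ => hd x)
  have e (x : Sp N) : fderiv ℝ (fun x : Sp N => x k * φ x) x (EuclideanSpace.single k 1) * φ x
      = φ x * φ x + x k * φ x * fderiv ℝ φ x (EuclideanSpace.single k 1) := by
    rw [fderiv_coord_mul hd]; simp; ring
  simp only [e] at ibp
  rw [integral_add (integrable_mul_of_memLp m1 m1) (integrable_mul_of_memLp m2 m3)] at ibp
  linarith

namespace SobD

variable {f : Sp N → ℝ} {g : Fin N → Sp N → ℝ}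

theorem integral_coord_mul_mul_grad (h : SobD f g) (k : Fin N) :
    ∫ x, (x k * f x) * g k x = -(1 / 2) * ∫ x, f x * f x := by
  obtain ⟨φ, hφ, h1, h2, h3⟩ := h.exists_approx
  have m1 n := memLp_of_contDiff_of_hasCompactSupport (hφ n).1 (hφ n).2
  have t1 := tendsto_integral_mul (h.memLp_coord k) (h.memLp_grad k)
    (fun n => memLp_coord_mul (hφ n).1 (hφ n).2 k)
    (fun n => memLp_fderiv_apply (hφ n).1 (hφ n).2 (EuclideanSpace.single k 1)) (h2 k) (h3 k)
  have t2 := tendsto_integral_mul h.memLp h.memLp m1 m1 h1 h1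
  simp only [fun n => integral_coord_mul_mul_fderiv (hφ n).1 (hφ n).2 k] at t1
  exact tendsto_nhds_unique t1 (t2.const_mul _)

/-- `g` is the weak gradient of `f`. -/
theorem integral_grad_mul (h : SobD f g) (k : Fin N) {ψ : Sp N → ℝ} (hψ : ContDiff ℝ ∞ ψ)
    (hm : MemLp ψ 2) (hm' : MemLp (fun x => fderiv ℝ ψ x (EuclideanSpace.single k 1)) 2) :
    ∫ x, g k x * ψ x = -∫ x, f x * fderiv ℝ ψ x (EuclideanSpace.single k 1) := by
  obtain ⟨φ, hφ, h1, h2, h3⟩ := h.exists_approx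
  have m1 n := memLp_of_contDiff_of_hasCompactSupport (hφ n).1 (hφ n).2
  have m3 n := memLp_fderiv_apply (hφ n).1 (hφ n).2 (EuclideanSpace.single k 1)
  have hconst {F : Sp N → ℝ} : Tendsto (fun _ : ℕ => eLpNorm (F - F) 2 volume) atTop (𝓝 0) := by
    simp
  have t1 := tendsto_integral_mul (h.memLp_grad k) hm m3 (fun _ => hm) (h3 k) hconst
  have t2 := tendsto_integral_mul h.memLp hm' m1 (fun _ => hm') h1 hconst
  refine tendsto_nhds_unique t1 (t2.neg.congr fun n => ?_)
  rw [integral_mul_fderiv_eq_neg_fderiv_mul_of_integrable (μ := volume)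
    ((m3 n).integrable_mul hm) ((m1 n).integrable_mul hm') ((m1 n).integrable_mul hm)
    (fun x _ => ((hφ n).1.differentiable (by simp)) x) (fun x _ => (hψ.differentiable (by simp)) x),
    neg_neg]

/-! ### Lowering operators, Hermite coefficients and the spectral gap. -/

theorem memLp_lower (h : SobD f g) (b : ℝ) (k : Fin N) :
    MemLp (fun x => g k x + 2 * b * (x k * f x)) 2 :=
  (h.memLp_grad k).add ((h.memLp_coord k).const_mul (2 * b))

theorem integral_lower_sq (h : SobD f g) (b : ℝ) (k : Fin N) :
    ∫ x, (g k x + 2 * b * (x k * f x)) ^ 2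
      = (∫ x, g k x ^ 2) + 4 * b ^ 2 * (∫ x, (x k * f x) ^ 2) - 2 * b * ∫ x, f x ^ 2 := by
  have e (x : Sp N) : (g k x + 2 * b * (x k * f x)) ^ 2 = g k x ^ 2 + 4 * b ^ 2 * (x k * f x) ^ 2
      + 4 * b * ((x k * f x) * g k x) := by ring
  simp only [e]
  have i1 := (h.memLp_grad k).integrable_sq
  have i2 := ((h.memLp_coord k).integrable_sq).const_mul (4 * b ^ 2)
  have i3 := (integrable_mul_of_memLp (h.memLp_coord k) (h.memLp_grad k)).const_mul (4 * b)
  rw [integral_add (i1.fun_add i2) i3, integral_add i1 i2, integral_const_mul, integral_const_mul,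
    h.integral_coord_mul_mul_grad]
  simp only [← pow_two]
  ring

/-- Adjointness of raising and lowering again, now with `f` only weakly differentiable: the
derivative is moved onto the Hermite function. -/
theorem integral_hermFun_mul_lower (h : SobD f g) (hb : 0 < b) (α : Fin N → ℕ) (k : Fin N) :
    ∫ x, hermFun b α x * (g k x + 2 * b * (x k * f x))
      = ∫ x, hermFun b (Function.update α k (α k + 1)) x * f x := by
  have m1 := memLp_hermFun hb α
  have m2 : MemLp (fun x => fderiv ℝ (hermFun b α) x (EuclideanSpace.single k 1)) 2 :=
    (gaussDecay_fderiv_hermFun b α k).memLp hb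
      (continuous_fderiv_apply (contDiff_hermFun b α) _).aestronglyMeasurable
  have i1 := integrable_mul_of_memLp (h.memLp_grad k) m1
  have i2 := (integrable_mul_of_memLp (h.memLp_coord k) m1).const_mul (2 * b)
  have i3 := integrable_mul_of_memLp h.memLp m2
  calc ∫ x, hermFun b α x * (g k x + 2 * b * (x k * f x))
      = ∫ x, (g k x * hermFun b α x + 2 * b * (x k * f x * hermFun b α x)) := by
        congr 1; ext x; ring
    _ = ∫ x, (2 * b * (x k * f x * hermFun b α x)
          - f x * fderiv ℝ (hermFun b α) x (EuclideanSpace.single k 1)) := by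
        rw [integral_add i1 i2, integral_sub i2 i3,
          h.integral_grad_mul k (contDiff_hermFun b α) m1 m2]
        ring
    _ = _ := by
        simp only [hermFun_update_succ]
        congr 1; ext x; ring

/-- The Hermite coefficients of `f`. -/
def coeff (h : SobD f g) (hb : 0 < b) (α : Fin N → ℕ) : ℝ :=
  inner ℝ (hermUnit hb α) (h.memLp.toLp f)

theorem inner_hermUnit_lower_sq (h : SobD f g) (hb : 0 < b) (α : Fin N → ℕ) (k : Fin N) :
    inner ℝ (hermUnit hb α) ((h.memLp_lower b k).toLp _) ^ 2
      = 4 * b * (α k + 1) * h.coeff hb (Function.update α k (α k + 1)) ^ 2 := by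
  have e1 : inner ℝ (hermLp hb α) ((h.memLp_lower b k).toLp _)
      = inner ℝ (hermLp hb (Function.update α k (α k + 1))) (h.memLp.toLp f) := by
    rw [hermLp, hermLp, inner_toLp_eq_integral, inner_toLp_eq_integral,
      h.integral_hermFun_mul_lower hb]
  have p1 := norm_hermLp_pos hb α
  have p2 := norm_hermLp_pos hb (Function.update α k (α k + 1))
  have e2 := norm_sq_hermLp_succ hb α k
  rw [coeff, hermUnit, hermUnit, real_inner_smul_left, real_inner_smul_left, e1, mul_pow, mul_pow,
    inv_pow, inv_pow, e2]
  have : (0 : ℝ) < α k + 1 := by positivity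
  field_simp

/-- Bessel's inequality for the lowered function: its coefficient at `β - e_k` has square `4b β_k`
times the squared coefficient of `f` at `β`. -/
theorem sum_coord_mul_coeff_sq_le (h : SobD f g) (hb : 0 < b) (k : Fin N)
    (S : Finset (Fin N → ℕ)) : ∑ β ∈ S, 4 * b * β k * h.coeff hb β ^ 2
      ≤ ∫ x, (g k x + 2 * b * (x k * f x)) ^ 2 := by
  classical
  rw [← norm_sq_toLp_eq_integral (h.memLp_lower b k)]
  -- Truncated decrement is injective only where `β k ≠ 0`; the remaining indices contribute zero.
  have hinj : Set.InjOn (fun β : Fin N → ℕ => Function.update β k (β k - 1))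
      (S.filter fun β => β k ≠ 0) := by
    intro β hβ γ hγ hβγ
    simp only [Finset.coe_filter, Set.mem_ofPred_eq] at hβ hγ hβγ
    rw [← update_pred_succ β k hβ.2, ← update_pred_succ γ k hγ.2, hβγ]
  refine le_trans (le_of_eq ?_) ((orthonormal_hermUnit hb).sum_inner_products_le
    ((h.memLp_lower b k).toLp _)
    (s := (S.filter fun β => β k ≠ 0).image fun β => Function.update β k (β k - 1)))
  rw [Finset.sum_image hinj, Finset.sum_filter]
  refine Finset.sum_congr rfl fun β _ => ?_
  split_ifs with hβ
  · rw [Real.norm_eq_abs, sq_abs, h.inner_hermUnit_lower_sq hb, update_pred_succ β k hβ]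
    congr 2
    rw [Function.update_self]
    norm_cast
    omega
  · simp [not_not.1 hβ]

theorem sum_degree_mul_coeff_sq_le (h : SobD f g) (hb : 0 < b) (S : Finset (Fin N → ℕ)) :
    ∑ β ∈ S, 4 * b * (∑ k, β k : ℕ) * h.coeff hb β ^ 2
      ≤ ∑ k, ∫ x, (g k x + 2 * b * (x k * f x)) ^ 2 := by
  refine le_trans (le_of_eq ?_)
    (Finset.sum_le_sum fun k _ => h.sum_coord_mul_coeff_sq_le hb k S)
  rw [Finset.sum_comm]
  refine Finset.sum_congr rfl fun β _ => ?_
  push_cast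
  rw [Finset.mul_sum, Finset.sum_mul]

theorem hasSum_coeff_sq (h : SobD f g) (hb : 0 < b) :
    HasSum (fun α => h.coeff hb α ^ 2) (∫ x, f x ^ 2) := by
  have := (hermBasis hb).hasSum_inner_mul_inner (h.memLp.toLp f) (h.memLp.toLp f)
  rw [real_inner_self_eq_norm_sq, norm_sq_toLp_eq_integral] at this
  refine this.congr_fun ?_
  intro α
  rw [hermBasis_apply, coeff, real_inner_comm, pow_two]

theorem coeff_zero (h : SobD f g) (hb : 0 < b) (h0 : ∫ x, f x * gauss b x = 0) :
    h.coeff hb 0 = 0 := by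
  rw [coeff, hermUnit, real_inner_smul_left, hermLp, inner_toLp_eq_integral]
  simp only [hermFun_zero, mul_comm (gauss b _), h0, mul_zero]

/-- The spectral gap of the harmonic oscillator above the ground state, with a remainder. -/
theorem gap_add_coeff (h : SobD f g) (hb : 0 < b) (h0 : ∫ x, f x * gauss b x = 0)
    (γ : Fin N → ℕ) :
    4 * b * (∫ x, f x ^ 2) + 4 * b * ((∑ k, γ k : ℕ) - 1) * h.coeff hb γ ^ 2
      ≤ ∑ k, ∫ x, (g k x + 2 * b * (x k * f x)) ^ 2 := by
  classical
  rw [← le_sub_iff_add_le]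
  refine hasSum_le_of_sum_le ((h.hasSum_coeff_sq hb).mul_left (4 * b)) fun S => ?_
  rw [le_sub_iff_add_le]
  -- Write degree as `1 + (degree - 1)`: the ones yield the mass, and the excess is nonnegative
  -- since the coefficient at `0` vanishes. Inserting `γ` ensures that its excess is counted.
  refine le_trans ?_ (h.sum_degree_mul_coeff_sq_le hb (insert γ S))
  have hle (β : Fin N → ℕ) : 0 ≤ 4 * b * ((∑ k, β k : ℕ) - 1 : ℝ) * h.coeff hb β ^ 2 := by
    by_cases hβ : β = 0
    · simp [hβ, h.coeff_zero hb h0]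
    · have : 1 ≤ ∑ k, β k := by
        by_contra! hlt
        have := Finset.sum_eq_zero_iff.1 (Nat.lt_one_iff.1 hlt)
        exact hβ (funext fun i => this i (Finset.mem_univ i))
      have : (1 : ℝ) ≤ (∑ k, β k : ℕ) := by exact_mod_cast this
      have : (0 : ℝ) ≤ (∑ k, β k : ℕ) - 1 := by linarith
      positivity
  have e (β : Fin N → ℕ) : 4 * b * (∑ k, β k : ℕ) * h.coeff hb β ^ 2
      = 4 * b * h.coeff hb β ^ 2 + 4 * b * ((∑ k, β k : ℕ) - 1 : ℝ) * h.coeff hb β ^ 2 := by ring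
  simp only [e]
  rw [Finset.sum_add_distrib]
  refine add_le_add ?_ ?_
  · exact Finset.sum_le_sum_of_subset_of_nonneg (Finset.subset_insert _ _)
      fun β _ _ => by positivity
  · exact Finset.single_le_sum (f := fun β : Fin N → ℕ =>
      4 * b * ((∑ k, β k : ℕ) - 1 : ℝ) * h.coeff hb β ^ 2) (fun β _ => hle β)
      (Finset.mem_insert_self γ S)

theorem gap (h : SobD f g) (hb : 0 < b) (h0 : ∫ x, f x * gauss b x = 0) :
    4 * b * (∫ x, f x ^ 2) ≤ ∑ k, ∫ x, (g k x + 2 * b * (x k * f x)) ^ 2 := by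
  simpa [h.coeff_zero hb h0] using h.gap_add_coeff hb h0 0

theorem hermFun_update_zero_one (b : ℝ) (k : Fin N) (x : Sp N) :
    hermFun b (Function.update 0 k 1) x = 4 * b * (x k * gauss b x) := by
  have := coord_mul_hermFun b (0 : Fin N → ℕ) k x
  simp only [hermFun_zero, Pi.zero_apply, zero_add, Nat.cast_zero, mul_zero, zero_mul,
    add_zero] at this
  exact this.symm

/-- The functions for which the spectral gap is attained. -/
theorem eq_linear_mul_gauss (h : SobD f g) (hb : 0 < b) (h0 : ∫ x, f x * gauss b x = 0)
    (heq : ∑ k, ∫ x, (g k x + 2 * b * (x k * f x)) ^ 2 = 4 * b * ∫ x, f x ^ 2) :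
    ∃ a : Fin N → ℝ, f =ᵐ[volume] fun x => (∑ k, a k * x k) * gauss b x := by
  -- Orthogonality to the Gaussian removes degree `0`. In degree at least `2` the remainder in
  -- `gap_add_coeff` has a positive factor, so equality in the gap forces the coefficient to vanish.
  have hc (γ : Fin N → ℕ) (hγ : ∑ k, γ k ≠ 1) : h.coeff hb γ = 0 := by
    by_cases hz : γ = 0
    · rw [hz, h.coeff_zero hb h0]
    have hγ2 : 2 ≤ ∑ k, γ k := by
      by_contra! hlt
      have := Finset.sum_eq_zero_iff.1 (show ∑ k, γ k = 0 by omega)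
      exact hz (funext fun i => this i (Finset.mem_univ i))
    have hγ2 : (2 : ℝ) ≤ (∑ k, γ k : ℕ) := by exact_mod_cast hγ2
    have hgap := h.gap_add_coeff hb h0 γ
    rw [heq] at hgap
    have h1 : 4 * b * ((∑ k, γ k : ℕ) - 1 : ℝ) * h.coeff hb γ ^ 2 ≤ 0 := by linarith
    have h2 : 0 < 4 * b * ((∑ k, γ k : ℕ) - 1 : ℝ) := mul_pos (by positivity) (by linarith)
    have h3 : h.coeff hb γ ^ 2 ≤ 0 := nonpos_of_mul_nonpos_right h1 h2
    exact pow_eq_zero_iff (two_ne_zero) |>.1 (le_antisymm h3 (sq_nonneg _))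
  have hinj : Function.Injective fun k : Fin N => Function.update (0 : Fin N → ℕ) k 1 := by
    intro k l hkl
    have := congrFun hkl k
    by_contra hne
    simp [Function.update_of_ne hne] at this
  have hs := (hermBasis hb).hasSum_repr (h.memLp.toLp f)
  have hs' := (hinj.hasSum_iff (fun γ hγ => by
    rw [HilbertBasis.repr_apply_apply, hermBasis_apply]
    have : h.coeff hb γ = 0 := by
      refine hc γ fun h1 => hγ ?_
      have hne : ∃ k, γ k ≠ 0 := by
        by_contra! hz
        simp [hz] at h1
      obtain ⟨k, hk⟩ := hne
      rw [← Finset.add_sum_erase _ _ (Finset.mem_univ k)] at h1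
      have hz := Finset.sum_eq_zero_iff.1 (show ∑ i ∈ Finset.univ.erase k, γ i = 0 by omega)
      refine ⟨k, funext fun i => ?_⟩
      by_cases hik : i = k
      · subst hik; simp; omega
      · simp only [Function.update_of_ne hik, Pi.zero_apply]
        exact (hz i (Finset.mem_erase.2 ⟨hik, Finset.mem_univ i⟩)).symm
    rw [coeff] at this
    rw [this, zero_smul])).2 hs
  have heqLp := hs'.unique (hasSum_fintype _)
  -- The factor `4 * b` comes from `hermFun_update_zero_one`, the inverse norm from normalising the
  -- basis.
  let a (k : Fin N) : ℝ := 4 * b * (h.coeff hb (Function.update 0 k 1) *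
    ‖hermLp hb (Function.update (0 : Fin N → ℕ) k 1)‖⁻¹)
  refine ⟨a, ?_⟩
  let F (k : Fin N) : Sp N → ℝ := fun x => a k * (x k * gauss b x)
  have hF (k : Fin N) : MemLp (F k) 2 :=
    (((gaussDecay_gauss b).coord_mul k).const_mul (a k)).memLp hb
      (continuous_const.mul ((contDiff_coord k).continuous.mul
        (continuous_gauss b))).aestronglyMeasurable
  have hterm (k : Fin N) : h.coeff hb (Function.update 0 k 1) • hermUnit hb (Function.update 0 k 1)
      = (hF k).toLp (F k) := by
    rw [hermUnit, smul_smul, hermLp, ← MemLp.toLp_const_smul]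
    refine MemLp.toLp_congr _ _ (ae_of_all _ fun x => ?_)
    simp only [Pi.smul_apply, smul_eq_mul, hermFun_update_zero_one, F, a, hermLp]
    ring
  have hsum : h.memLp.toLp f = ∑ k, (hF k).toLp (F k) := by
    rw [heqLp]
    refine Finset.sum_congr rfl fun k _ => ?_
    rw [← hterm k, Function.comp_apply, HilbertBasis.repr_apply_apply, hermBasis_apply, coeff]
  have hae : ∀ᵐ x, ∀ k, (hF k).toLp (F k) x = F k x := ae_all_iff.2 fun k => (hF k).coeFn_toLp
  filter_upwards [h.memLp.coeFn_toLp, Lp.coeFn_finsetSum Finset.univ fun k => (hF k).toLp (F k), hae]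
    with x h1 h2 h3
  rw [← h1, hsum, h2]
  simp only [Finset.sum_apply, h3, F, Finset.sum_mul, mul_assoc]

/-- Conversely, the gap is attained at `f = (a · x) e^{-b|x|²}`. -/
theorem gap_eq_of_lower_eq (h : SobD f g) (hb : 0 < b) (a : Fin N → ℝ)
    (hf : ∀ x, f x = (∑ k, a k * x k) * gauss b x)
    (hg : ∀ k x, g k x + 2 * b * (x k * f x) = a k * gauss b x) :
    ∑ k, ∫ x, (g k x + 2 * b * (x k * f x)) ^ 2 = 4 * b * ∫ x, f x ^ 2 := by
  have hi (k : Fin N) : Integrable fun x => a k * (x k * gauss b x * f x) := by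
    have := (((gaussDecay_gauss b).coord_mul k).memLp hb ((contDiff_coord k).continuous.mul
        (continuous_gauss b)).aestronglyMeasurable).integrable_mul h.memLp
    exact this.const_mul (a k)
  have e1 : ∫ x, f x ^ 2 = ∑ k, a k * ∫ x, x k * gauss b x * f x := by
    simp only [← integral_const_mul]
    rw [← integral_finsetSum _ fun k _ => hi k]
    congr 1; ext x
    rw [pow_two]
    nth_rewrite 1 [hf x]
    rw [Finset.sum_mul, Finset.sum_mul]
    refine Finset.sum_congr rfl fun k _ => by ring
  rw [e1, Finset.mul_sum]
  refine Finset.sum_congr rfl fun k _ => ?_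
  -- One copy of the lowered function is `a k * gauss b`; adjointness turns the other into a pairing
  -- of `f` with `4 * b * (x k * gauss b x)`.
  have := h.integral_hermFun_mul_lower hb 0 k
  simp only [hermFun_zero, Pi.zero_apply, zero_add, hermFun_update_zero_one] at this
  calc ∫ x, (g k x + 2 * b * (x k * f x)) ^ 2
      = a k * ∫ x, gauss b x * (g k x + 2 * b * (x k * f x)) := by
        rw [← integral_const_mul]
        simp only [hg]
        congr 1; ext x; ring
    _ = _ := by
        rw [this, ← integral_const_mul, ← integral_const_mul, ← integral_const_mul]
        congr 1; ext x; ring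

end SobD

/-! ### Components of fields in `𝒟` -/

theorem tendsto_eLpNorm_zero_of_le {F : ℕ → Sp N → ℝ} {d : ℕ → ℝ≥0∞}
    (h : ∀ n, ∫⁻ x, ‖F n x‖ₑ ^ 2 ≤ d n) (hd : Tendsto d atTop (𝓝 0)) :
    Tendsto (fun n => eLpNorm (F n) 2 volume) atTop (𝓝 0) := by
  have hd' : Tendsto (fun n => d n ^ (1 / 2 : ℝ)) atTop (𝓝 0) := by
    have := (ENNReal.continuous_rpow_const (y := (1 / 2 : ℝ))).tendsto 0 |>.comp hd
    simpa [Function.comp_def] using this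
  refine tendsto_of_tendsto_of_tendsto_of_le_of_le tendsto_const_nhds hd' (fun _ => zero_le)
    fun n => ?_
  rw [eLpNorm_eq_lintegral_rpow_enorm_toReal two_ne_zero ENNReal.ofNat_ne_top]
  simp only [ENNReal.toReal_ofNat]
  refine ENNReal.rpow_le_rpow ?_ (by norm_num)
  refine le_trans (le_of_eq ?_) (h n)
  simp only [← ENNReal.rpow_natCast]
  norm_num

theorem memLp_of_tendsto_eLpNorm {φ : ℕ → Sp N → ℝ} {f : Sp N → ℝ}
    (hf : AEStronglyMeasurable f volume) (hφ : ∀ n, MemLp (φ n) 2)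
    (h : Tendsto (fun n => eLpNorm (φ n - f) 2 volume) atTop (𝓝 0)) : MemLp f 2 := by
  obtain ⟨n, hn⟩ := (h.eventually (gt_mem_nhds ENNReal.zero_lt_top)).exists
  have h1 : MemLp (φ n - f) 2 := ⟨(hφ n).1.sub hf, hn⟩
  simpa using (hφ n).sub h1

theorem enorm_apply_le (x : Sp N) (k : Fin N) : ‖x k‖ₑ ≤ ‖x‖ₑ := by
  simpa [enorm_le_iff_norm_le] using PiLp.norm_apply_le x k

theorem contDiff_apply_of_contDiff {u : Sp N → Sp N} (hu : ContDiff ℝ ∞ u) (j : Fin N) :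
    ContDiff ℝ ∞ fun x => u x j :=
  (contDiff_coord j).comp hu

theorem fderiv_apply_eq_jac {u : Sp N → Sp N} (hu : Differentiable ℝ u) (j k : Fin N)
    (x : Sp N) : fderiv ℝ (fun x => u x j) x (EuclideanSpace.single k 1) = jac u x j k := by
  have h := ((EuclideanSpace.proj (𝕜 := ℝ) j : Sp N →L[ℝ] ℝ).hasFDerivAt (x := u x)).comp x
    (hu x).hasFDerivAt
  have h' : fderiv ℝ (fun x => u x j) x
    = (EuclideanSpace.proj (𝕜 := ℝ) j : Sp N →L[ℝ] ℝ) ∘L fderiv ℝ u x := h.fderiv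
  rw [h']
  rfl

/-- Reduces fields to scalar components: `distSqD` dominates each squared `L²` distance needed. The
limits are square integrable because test functions are. -/
theorem MemD.sobD {u : Sp N → Sp N} {G : Sp N → Matrix (Fin N) (Fin N) ℝ} (h : MemD u G)
    (j : Fin N) : SobD (fun x => u x j) (fun k x => G x j k) := by
  obtain ⟨hu, hG, φ, hφ, hlim⟩ := h
  have hψ n : ContDiff ℝ ∞ (fun x => φ n x j) ∧ HasCompactSupport (fun x => φ n x j) :=
    ⟨contDiff_apply_of_contDiff (hφ n).1 j,
      (hφ n).2.comp_left (g := fun y : Sp N => y j) (by simp)⟩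
  have huj : AEStronglyMeasurable (fun x => u x j) volume :=
    (contDiff_coord j).continuous.comp_aestronglyMeasurable hu
  have t1 : Tendsto (fun n => eLpNorm ((fun x => φ n x j) - fun x => u x j) 2 volume)
      atTop (𝓝 0) := by
    refine tendsto_eLpNorm_zero_of_le (fun n => ?_) hlim
    rw [distSqD, add_assoc]
    refine le_trans (lintegral_mono fun x => ?_) le_self_add
    simp only [Pi.sub_apply]
    gcongr
    exact enorm_apply_le (φ n x - u x) j
  have t2 (k : Fin N) : Tendsto (fun n => eLpNorm
      ((fun x => x k * φ n x j) - fun x => x k * u x j) 2 volume) atTop (𝓝 0) := by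
    refine tendsto_eLpNorm_zero_of_le (fun n => ?_) hlim
    rw [distSqD, add_right_comm]
    refine le_trans (lintegral_mono fun x => ?_) le_add_self
    simp only [Pi.sub_apply]
    rw [← mul_sub, enorm_mul, mul_pow, mul_comm]
    gcongr
    · exact enorm_apply_le (φ n x - u x) j
    · exact enorm_apply_le x k
  have t3 (k : Fin N) : Tendsto (fun n => eLpNorm
      ((fun x => fderiv ℝ (fun x => φ n x j) x (EuclideanSpace.single k 1)) - fun x => G x j k)
      2 volume) atTop (𝓝 0) := by
    refine tendsto_eLpNorm_zero_of_le (fun n => ?_) hlim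
    rw [distSqD]
    refine le_trans (lintegral_mono fun x => ?_) le_add_self
    simp only [Pi.sub_apply]
    rw [fderiv_apply_eq_jac ((hφ n).1.differentiable (by simp))]
    refine le_trans ?_ (Finset.single_le_sum
      (f := fun j => ∑ k, ‖jac (φ n) x j k - G x j k‖ₑ ^ 2) (fun _ _ => zero_le)
      (Finset.mem_univ j))
    exact Finset.single_le_sum
      (f := fun k => ‖jac (φ n) x j k - G x j k‖ₑ ^ 2) (fun _ _ => zero_le)
      (Finset.mem_univ k)
  exact
    { memLp := memLp_of_tendsto_eLpNorm huj
        (fun n => memLp_of_contDiff_of_hasCompactSupport (hψ n).1 (hψ n).2) t1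
      memLp_coord := fun k => memLp_of_tendsto_eLpNorm
        ((contDiff_coord k).continuous.aestronglyMeasurable.mul huj)
        (fun n => memLp_coord_mul (hψ n).1 (hψ n).2 k) (t2 k)
      memLp_grad := fun k => memLp_of_tendsto_eLpNorm (hG j k)
        (fun n => memLp_fderiv_apply (hψ n).1 (hψ n).2 _) (t3 k)
      exists_approx := ⟨_, hψ, t1, t2, t3⟩ }

/-! ### Toroidal fields and the uncertainty inequality. -/

section Fields

variable {u : Sp N → Sp N} {G : Sp N → Matrix (Fin N) (Fin N) ℝ}

theorem MemD.integrable_norm_sq (h : MemD u G) : Integrable fun x => ‖u x‖ ^ 2 := by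
  simp only [EuclideanSpace.real_norm_sq_eq]
  exact integrable_finsetSum _ fun j _ => (h.sobD j).memLp.integrable_sq

theorem MemD.massInt_eq (h : MemD u G) : massInt u = ∑ j, ∫ x, u x j ^ 2 := by
  simp only [massInt, EuclideanSpace.real_norm_sq_eq]
  exact integral_finsetSum _ fun j _ => (h.sobD j).memLp.integrable_sq

theorem MemD.momentInt_eq (h : MemD u G) : momentInt u = ∑ j, ∑ k, ∫ x, (x k * u x j) ^ 2 := by
  have e (x : Sp N) : ‖u x‖ ^ 2 * ‖x‖ ^ 2 = ∑ j, ∑ k, (x k * u x j) ^ 2 := by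
    simp only [EuclideanSpace.real_norm_sq_eq, Finset.sum_mul_sum, mul_pow, mul_comm (x _ ^ 2)]
  have i (j k : Fin N) := ((h.sobD j).memLp_coord k).integrable_sq
  simp only [momentInt, e]
  rw [integral_finsetSum _ fun j _ => integrable_finsetSum _ fun k _ => i j k]
  exact Finset.sum_congr rfl fun j _ => integral_finsetSum _ fun k _ => i j k

theorem MemD.gradInt_eq (h : MemD u G) : gradInt G = ∑ j, ∑ k, ∫ x, G x j k ^ 2 := by
  have i (j k : Fin N) := ((h.sobD j).memLp_grad k).integrable_sq
  rw [gradInt, integral_finsetSum _ fun j _ => integrable_finsetSum _ fun k _ => i j k]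
  exact Finset.sum_congr rfl fun j _ => integral_finsetSum _ fun k _ => i j k

theorem MemD.sum_integral_lower_sq (h : MemD u G) (b : ℝ) :
    ∑ j, ∑ k, ∫ x, (G x j k + 2 * b * (x k * u x j)) ^ 2
      = gradInt G + 4 * b ^ 2 * momentInt u - 2 * b * N * massInt u := by
  simp only [fun j k => (h.sobD j).integral_lower_sq b k, h.gradInt_eq, h.momentInt_eq,
    h.massInt_eq, Finset.sum_sub_distrib, Finset.sum_add_distrib, ← Finset.mul_sum,
    Finset.sum_const, Finset.card_univ, Fintype.card_fin, nsmul_eq_mul]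
  ring

theorem inner_eq_zero_of_radial_eq_zero {x : Sp N} (h : radial u x = 0) :
    ∑ k, x k * u x k = 0 := by
  have e : inner ℝ x (u x) = ∑ k, x k * u x k := by
    rw [PiLp.inner_apply]
    simp [mul_comm]
  rw [← e]
  rw [radial, real_inner_smul_left, mul_eq_zero, inv_eq_zero, norm_eq_zero] at h
  -- At the origin `radial` is zero by the convention `0⁻¹ = 0`, but there `x · u` vanishes anyway.
  rcases h with h | h
  · rw [h, inner_zero_left]
  · exact h

theorem fderiv_gauss (b : ℝ) (k : Fin N) (x : Sp N) :
    fderiv ℝ (gauss b) x (EuclideanSpace.single k 1) = -(2 * b) * (x k * gauss b x) := by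
  rw [← hermFun_zero, fderiv_hermFun]
  simp

theorem fderiv_coord_mul_gauss (b : ℝ) (j k : Fin N) (x : Sp N) :
    fderiv ℝ (fun x : Sp N => x j * gauss b x) x (EuclideanSpace.single k 1)
      = (if j = k then gauss b x else 0) - 2 * b * (x j * (x k * gauss b x)) := by
  rw [fderiv_coord_mul ((contDiff_gauss b).differentiable (by simp)), fderiv_gauss]
  ring

theorem contDiff_coord_mul_gauss (b : ℝ) (j : Fin N) :
    ContDiff ℝ ∞ fun x : Sp N => x j * gauss b x :=
  (contDiff_coord j).mul (contDiff_gauss b)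

theorem gaussDecay_fderiv_coord_mul_gauss (b : ℝ) (j k : Fin N) : GaussDecay b fun x : Sp N =>
    fderiv ℝ (fun x : Sp N => x j * gauss b x) x (EuclideanSpace.single k 1) := by
  simp only [fderiv_coord_mul_gauss]
  have h1 : GaussDecay b fun x : Sp N => if j = k then gauss b x else 0 := by
    by_cases hjk : j = k
    · simpa [hjk] using gaussDecay_gauss b
    · simpa [hjk] using GaussDecay.zero
  have h2 := ((((gaussDecay_gauss (N := N) b).coord_mul k).coord_mul j).const_mul (-(2 * b)))
  simpa only [sub_eq_add_neg, neg_mul] using h1.add h2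

/-- The components of a toroidal field are orthogonal to radial Gaussians. -/
theorem integral_apply_mul_gauss_eq_zero (h : MemD u G) (ht : IsToroidal u G) (hb : 0 < b)
    (j : Fin N) : ∫ x, u x j * gauss b x = 0 := by
  have hc := contDiff_coord_mul_gauss (N := N) b j
  have m1 : MemLp (fun x : Sp N => x j * gauss b x) 2 :=
    ((gaussDecay_gauss b).coord_mul j).memLp hb hc.continuous.aestronglyMeasurable
  have m2 (k : Fin N) := (gaussDecay_fderiv_coord_mul_gauss b j k).memLp hb
    (continuous_fderiv_apply hc (EuclideanSpace.single k 1)).aestronglyMeasurable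
  -- The divergence is tested against `x_j e^{-b|x|²}`, whose gradient is `e^{-b|x|²} e_j` plus a
  -- multiple of `x`; the latter is orthogonal to `u`.
  have hs : ∑ k, ∫ x, G x k k * (x j * gauss b x) = -∑ k, ∫ x, u x k *
      fderiv ℝ (fun x : Sp N => x j * gauss b x) x (EuclideanSpace.single k 1) := by
    rw [← Finset.sum_neg_distrib]
    exact Finset.sum_congr rfl fun k _ => (h.sobD k).integral_grad_mul k hc m1 (m2 k)
  rw [← integral_finsetSum _ fun k _ => integrable_mul_of_memLp ((h.sobD k).memLp_grad k) m1,
    ← integral_finsetSum _ fun k _ => integrable_mul_of_memLp (h.sobD k).memLp (m2 k)] at hs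
  have hl : ∫ x, ∑ k, G x k k * (x j * gauss b x) = 0 := by
    refine integral_eq_zero_of_ae ?_
    filter_upwards [ht.2] with x hx
    rw [← Finset.sum_mul]
    change (G x).trace * _ = 0
    rw [hx, zero_mul]
  rw [hl, eq_comm, neg_eq_zero] at hs
  rw [← hs]
  refine integral_congr_ae ?_
  filter_upwards [ht.1] with x hx
  have hx' := inner_eq_zero_of_radial_eq_zero hx
  simp only [fderiv_coord_mul_gauss, mul_sub, Finset.sum_sub_distrib, mul_ite, mul_zero,
    Finset.sum_ite_eq, Finset.mem_univ, if_true]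
  have : ∑ k, u x k * (2 * b * (x j * (x k * gauss b x)))
      = 2 * b * x j * gauss b x * ∑ k, x k * u x k := by
    rw [Finset.mul_sum]
    exact Finset.sum_congr rfl fun k _ => by ring
  rw [this, hx', mul_zero, sub_zero]

/-- In `N + 2`, the `N` is the ground state energy coming from the cross terms and the `2` is the
spectral gap. -/
theorem MemD.energy_ge (h : MemD u G) (ht : IsToroidal u G) (hb : 0 < b) :
    2 * b * (N + 2) * massInt u ≤ gradInt G + 4 * b ^ 2 * momentInt u := by
  have h1 : 4 * b * massInt u ≤ ∑ j, ∑ k, ∫ x, (G x j k + 2 * b * (x k * u x j)) ^ 2 := by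
    rw [h.massInt_eq, Finset.mul_sum]
    exact Finset.sum_le_sum fun j _ =>
      (h.sobD j).gap hb (integral_apply_mul_gauss_eq_zero h ht hb j)
  rw [h.sum_integral_lower_sq] at h1
  linarith

theorem massInt_nonneg (u : Sp N → Sp N) : 0 ≤ massInt u := integral_nonneg fun x => by positivity

theorem momentInt_nonneg (u : Sp N → Sp N) : 0 ≤ momentInt u :=
  integral_nonneg fun x => by positivity

theorem gradInt_nonneg (G : Sp N → Matrix (Fin N) (Fin N) ℝ) : 0 ≤ gradInt G :=
  integral_nonneg fun _ => Finset.sum_nonneg fun _ _ => Finset.sum_nonneg fun _ _ => sq_nonneg _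

theorem MemD.massInt_pos (h : MemD u G) (hu : ¬ u =ᵐ[volume] 0) : 0 < massInt u := by
  refine lt_of_le_of_ne (massInt_nonneg u) fun h0 => hu ?_
  have := (integral_eq_zero_iff_of_nonneg (fun x => by positivity) h.integrable_norm_sq).1 h0.symm
  filter_upwards [this] with x hx
  simpa using hx

theorem mul_sq_le_mul_of_forall_energy_ge {n g M m : ℝ} (hn : 0 < n) (hg : 0 ≤ g) (hM : 0 ≤ M)
    (hm : 0 ≤ m) (h : ∀ b, 0 < b → 2 * b * n * m ≤ g + 4 * b ^ 2 * M) :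
    n ^ 2 / 4 * m ^ 2 ≤ g * M := by
  rcases hm.eq_or_lt with rfl | hm
  · simpa using mul_nonneg hg hM
  rcases hM.eq_or_lt with rfl | hM
  -- With `M = 0` the left side is unbounded in `b`; this `b` makes it `g + 1`, a contradiction.
  · have := h ((g + 1) / (2 * n * m)) (by positivity)
    have e : 2 * ((g + 1) / (2 * n * m)) * n * m = g + 1 := by field_simp
    rw [e] at this
    linarith
  -- This `b` minimises `4b² M - 2bnm`.
  · have := h (n * m / (4 * M)) (by positivity)
    have e1 : 2 * (n * m / (4 * M)) * n * m = 2 * (n ^ 2 / 4 * m ^ 2) / M := by field_simp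
    have e2 : 4 * (n * m / (4 * M)) ^ 2 * M = (n ^ 2 / 4 * m ^ 2) / M := by field_simp
    rw [e1, e2] at this
    rw [← div_le_iff₀ hM]
    have e3 : 2 * (n ^ 2 / 4 * m ^ 2) / M = 2 * ((n ^ 2 / 4 * m ^ 2) / M) := by ring
    linarith

theorem MemD.toroidal_uncertainty (h : MemD u G) (ht : IsToroidal u G) :
    ((N : ℝ) + 2) ^ 2 / 4 * massInt u ^ 2 ≤ gradInt G * momentInt u :=
  mul_sq_le_mul_of_forall_energy_ge (by positivity) (gradInt_nonneg G) (momentInt_nonneg u)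
    (massInt_nonneg u) fun _ hb => h.energy_ge ht hb

end Fields

/-! ### Smooth fields with Gaussian decay -/

theorem tendsto_lintegral_zero_of_eventually_eq_zero {F : ℕ → Sp N → ℝ≥0∞} {B : Sp N → ℝ}
    (hF : ∀ n, Measurable (F n)) (hB : Integrable B) (hle : ∀ n x, F n x ≤ ENNReal.ofReal (B x))
    (h0 : ∀ x, ∀ᶠ n in atTop, F n x = 0) : Tendsto (fun n => ∫⁻ x, F n x) atTop (𝓝 0) := by
  have := tendsto_lintegral_of_dominated_convergence (μ := volume) (F := F) (f := fun _ => 0)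
    (fun x => ENNReal.ofReal (B x)) hF (fun n => ae_of_all _ (hle n)) hB.lintegral_lt_top.ne
    (ae_of_all _ fun x => tendsto_const_nhds.congr' ((h0 x).mono fun n hn => hn.symm))
  simpa using this

theorem enorm_sq_le_ofReal {E : Type*} [NormedAddCommGroup E] {v : E} {r : ℝ} (h : ‖v‖ ^ 2 ≤ r) :
    ‖v‖ₑ ^ 2 ≤ ENNReal.ofReal r := by
  rw [← ofReal_norm, ← ENNReal.ofReal_pow (norm_nonneg _)]
  exact ENNReal.ofReal_le_ofReal h

/-- Smooth cutoff functions, equal to `1` for `|x| ≤ n + 1`. -/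
def cutoff (N n : ℕ) (x : Sp N) : ℝ :=
  (⟨1, 2, one_pos, one_lt_two⟩ : ContDiffBump (0 : Sp N)) (((n : ℝ) + 1)⁻¹ • x)

theorem contDiff_cutoff (n : ℕ) : ContDiff ℝ ∞ (cutoff N n) :=
  (ContDiffBump.contDiff _).comp (contDiff_const_smul _)

theorem cutoff_nonneg (n : ℕ) (x : Sp N) : 0 ≤ cutoff N n x := ContDiffBump.nonneg _

theorem cutoff_le_one (n : ℕ) (x : Sp N) : cutoff N n x ≤ 1 := ContDiffBump.le_one _

theorem hasCompactSupport_cutoff (n : ℕ) : HasCompactSupport (cutoff N n) :=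
  (ContDiffBump.hasCompactSupport _).comp_smul (by positivity)

theorem cutoff_eq_one {n : ℕ} {x : Sp N} (h : ‖x‖ < n + 1) : cutoff N n x = 1 := by
  refine ContDiffBump.one_of_mem_closedBall _ ?_
  rw [mem_closedBall_zero_iff, norm_smul, norm_inv, Real.norm_of_nonneg (by positivity),
    inv_mul_le_iff₀ (by positivity)]
  simpa using h.le

/-- Rescaling multiplies the derivative of the fixed bump by `1/(n+1) ≤ 1`, so the bound is uniform
in `n`. -/
theorem exists_norm_fderiv_cutoff_le (N : ℕ) :
    ∃ C : ℝ, ∀ n x (k : Fin N), |fderiv ℝ (cutoff N n) x (EuclideanSpace.single k 1)| ≤ C := by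
  let χ : ContDiffBump (0 : Sp N) := ⟨1, 2, one_pos, one_lt_two⟩
  have hχ : ContDiff ℝ ∞ χ := χ.contDiff
  obtain ⟨C, hC⟩ := (χ.hasCompactSupport.fderiv ℝ).exists_bound_of_continuous
    (hχ.continuous_fderiv (by simp))
  refine ⟨C, fun n x k => ?_⟩
  have hd : HasFDerivAt (cutoff N n)
      ((fderiv ℝ χ (((n : ℝ) + 1)⁻¹ • x)) ∘L (((n : ℝ) + 1)⁻¹ • ContinuousLinearMap.id ℝ (Sp N)))
      x :=
    ((hχ.differentiable (by simp) _).hasFDerivAt).comp x ((hasFDerivAt_id (𝕜 := ℝ) x).fun_const_smul _)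
  have hn : ((n : ℝ) + 1)⁻¹ ≤ 1 := inv_le_one_of_one_le₀ (by linarith [n.cast_nonneg (α := ℝ)])
  have hC0 : 0 ≤ C := (norm_nonneg _).trans (hC 0)
  rw [hd.fderiv]
  simp only [ContinuousLinearMap.comp_apply, smul_apply,
    ContinuousLinearMap.id_apply, map_smul, smul_eq_mul, abs_mul, abs_inv]
  rw [abs_of_nonneg (by positivity)]
  have h1 : |fderiv ℝ χ (((n : ℝ) + 1)⁻¹ • x) (EuclideanSpace.single k 1)| ≤ C := by
    refine ((fderiv ℝ χ _).le_opNorm _).trans ?_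
    simpa using hC _
  calc _ ≤ 1 * C := mul_le_mul hn h1 (abs_nonneg _) zero_le_one
    _ = C := one_mul C

theorem jac_smul {u : Sp N → Sp N} {η : Sp N → ℝ} (hη : Differentiable ℝ η)
    (hu : Differentiable ℝ u) (x : Sp N) (j k : Fin N) : jac (fun x => η x • u x) x j k
      = η x * jac u x j k + fderiv ℝ η x (EuclideanSpace.single k 1) * u x j := by
  simp only [jac]
  rw [((hη x).hasFDerivAt.fun_smul (hu x).hasFDerivAt).fderiv]
  simp

theorem continuous_jac {u : Sp N → Sp N} (hu : ContDiff ℝ ∞ u) (j k : Fin N) :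
    Continuous fun x => jac u x j k :=
  (contDiff_coord j).continuous.comp
    ((hu.continuous_fderiv (by simp)).clm_apply continuous_const)

/-- The cutoff fields approximate `u` by dominated convergence: at each point all the differences
vanish for large `n`, including those of the gradients, as the cutoff is `1` nearby. -/
theorem memD_of_gaussDecay {u : Sp N → Sp N} {c : ℝ} (hc : 0 < c) (hu : ContDiff ℝ ∞ u)
    (d : GaussDecay c u) (dJ : ∀ j k, GaussDecay c fun x => jac u x j k) : MemD u (jac u) := by
  have hcu := hu.continuous
  have hdu : Differentiable ℝ u := hu.differentiable (by simp)
  have hdη n : Differentiable ℝ (cutoff N n) := (contDiff_cutoff n).differentiable (by simp)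
  have hφ n : ContDiff ℝ ∞ fun x => cutoff N n x • u x := (contDiff_cutoff n).smul hu
  refine ⟨hcu.aestronglyMeasurable, fun j k => (continuous_jac hu j k).aestronglyMeasurable,
    fun n x => cutoff N n x • u x, fun n => ⟨hφ n, (hasCompactSupport_cutoff n).smul_right⟩, ?_⟩
  have hev (x : Sp N) : ∀ᶠ n : ℕ in atTop, ‖x‖ < n + 1 := by
    obtain ⟨m, hm⟩ := exists_nat_gt ‖x‖
    filter_upwards [eventually_ge_atTop m] with n hn
    have : (m : ℝ) ≤ n := by exact_mod_cast hn
    linarith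
  have hsub n (x : Sp N) : ‖cutoff N n x • u x - u x‖ ^ 2 ≤ ‖u x‖ ^ 2 := by
    have : cutoff N n x • u x - u x = (cutoff N n x - 1) • u x := by rw [sub_smul, one_smul]
    rw [this, norm_smul]
    have h1 : ‖cutoff N n x - 1‖ ≤ 1 := by
      rw [Real.norm_eq_abs, abs_le]
      constructor <;> linarith [cutoff_nonneg n x, cutoff_le_one n x]
    gcongr
    exact mul_le_of_le_one_left (norm_nonneg _) h1
  have i1 : Integrable fun x => ‖u x‖ ^ 2 :=
    (d.memLp hc hcu.aestronglyMeasurable).integrable_norm_pow two_ne_zero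
  have i2 : Integrable fun x => ‖u x‖ ^ 2 * ‖x‖ ^ 2 := by
    have := ((d.norm.mul d.norm).mul (GaussDecay.norm_pow 2)).integrable (by positivity)
      (hcu.norm.mul hcu.norm |>.mul (continuous_norm.pow 2)).aestronglyMeasurable
    simpa only [pow_two] using this
  have i3 (j k : Fin N) : Integrable fun x => jac u x j k ^ 2 :=
    ((dJ j k).memLp hc (continuous_jac hu j k).aestronglyMeasurable).integrable_sq
  have t1 : Tendsto (fun n => ∫⁻ x, ‖cutoff N n x • u x - u x‖ₑ ^ 2) atTop (𝓝 0) := by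
    refine tendsto_lintegral_zero_of_eventually_eq_zero (fun n => ?_) i1
      (fun n x => enorm_sq_le_ofReal (hsub n x)) fun x => ?_
    · exact ((hφ n).continuous.sub hcu).enorm.measurable.pow_const 2
    · filter_upwards [hev x] with n hn
      simp [cutoff_eq_one hn]
  have t2 : Tendsto (fun n => ∫⁻ x, ‖cutoff N n x • u x - u x‖ₑ ^ 2 * ‖x‖ₑ ^ 2) atTop (𝓝 0) := by
    refine tendsto_lintegral_zero_of_eventually_eq_zero (fun n => ?_) i2 (fun n x => ?_)
      fun x => ?_
    · exact (((hφ n).continuous.sub hcu).enorm.measurable.pow_const 2).mul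
        (continuous_enorm.measurable.pow_const 2)
    · rw [ENNReal.ofReal_mul (by positivity)]
      exact mul_le_mul' (enorm_sq_le_ofReal (hsub n x)) (enorm_sq_le_ofReal le_rfl)
    · filter_upwards [hev x] with n hn
      simp [cutoff_eq_one hn]
  obtain ⟨C, hC⟩ := exists_norm_fderiv_cutoff_le N
  have t3 (j k : Fin N) : Tendsto (fun n => ∫⁻ x,
      ‖jac (fun x => cutoff N n x • u x) x j k - jac u x j k‖ₑ ^ 2) atTop (𝓝 0) := by
    refine tendsto_lintegral_zero_of_eventually_eq_zero
      (B := fun x => 2 * jac u x j k ^ 2 + 2 * C ^ 2 * ‖u x‖ ^ 2) (fun n => ?_)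
      (((i3 j k).const_mul 2).add (i1.const_mul (2 * C ^ 2))) (fun n x => enorm_sq_le_ofReal ?_)
      fun x => ?_
    · exact ((continuous_jac (hφ n) j k).sub (continuous_jac hu j k)).enorm.measurable.pow_const 2
    · rw [jac_smul (hdη n) hdu, Real.norm_eq_abs, sq_abs]
      have e1 : ((cutoff N n x - 1) * jac u x j k) ^ 2 ≤ jac u x j k ^ 2 := by
        rw [mul_pow]
        refine mul_le_of_le_one_left (sq_nonneg _) ?_
        rw [sq_le_one_iff_abs_le_one, abs_le]
        constructor <;> linarith [cutoff_nonneg n x, cutoff_le_one n x]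
      have e2 : (fderiv ℝ (cutoff N n) x (EuclideanSpace.single k 1) * u x j) ^ 2
          ≤ C ^ 2 * ‖u x‖ ^ 2 := by
        rw [mul_pow]
        refine mul_le_mul ?_ ?_ (sq_nonneg _) (sq_nonneg _)
        · exact sq_le_sq' (abs_le.1 (hC n x k)).1 (abs_le.1 (hC n x k)).2
        · rw [← sq_abs]
          exact pow_le_pow_left₀ (abs_nonneg _) (PiLp.norm_apply_le (u x) j) 2
      have e3 : (cutoff N n x * jac u x j k
          + fderiv ℝ (cutoff N n) x (EuclideanSpace.single k 1) * u x j - jac u x j k) ^ 2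
          ≤ 2 * ((cutoff N n x - 1) * jac u x j k) ^ 2
            + 2 * (fderiv ℝ (cutoff N n) x (EuclideanSpace.single k 1) * u x j) ^ 2 := by
        nlinarith [sq_nonneg ((cutoff N n x - 1) * jac u x j k
          - fderiv ℝ (cutoff N n) x (EuclideanSpace.single k 1) * u x j)]
      linarith
    · filter_upwards [hev x] with n hn
      have hnear : (fun y => cutoff N n y • u y) =ᶠ[𝓝 x] u := by
        filter_upwards [(isOpen_lt continuous_norm continuous_const).mem_nhds hn] with y hy
        rw [cutoff_eq_one hy, one_smul]
      simp [jac, hnear.fderiv_eq]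
  have t3' : Tendsto (fun n => ∫⁻ x, ∑ j, ∑ k,
      ‖jac (fun x => cutoff N n x • u x) x j k - jac u x j k‖ₑ ^ 2) atTop (𝓝 0) := by
    have hm n (j k : Fin N) : Measurable fun x =>
        ‖jac (fun x => cutoff N n x • u x) x j k - jac u x j k‖ₑ ^ 2 :=
      ((continuous_jac (hφ n) j k).sub (continuous_jac hu j k)).enorm.measurable.pow_const 2
    have e n : ∫⁻ x, ∑ j, ∑ k, ‖jac (fun x => cutoff N n x • u x) x j k - jac u x j k‖ₑ ^ 2
        = ∑ j, ∑ k, ∫⁻ x, ‖jac (fun x => cutoff N n x • u x) x j k - jac u x j k‖ₑ ^ 2 := by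
      rw [lintegral_finsetSum _ fun j _ => Finset.measurable_fun_sum _ fun k _ => hm n j k]
      exact Finset.sum_congr rfl fun j _ => lintegral_finsetSum _ fun k _ => hm n j k
    simp only [e]
    simpa using tendsto_finsetSum Finset.univ fun j _ =>
      tendsto_finsetSum Finset.univ fun k _ => t3 j k
  simpa only [distSqD, add_zero] using (t1.add t2).add t3'

theorem decayCond_of_gaussDecay {u : Sp N → Sp N} {c : ℝ} (hc : 0 < c) (d : GaussDecay c u) :
    DecayCond u := by
  obtain ⟨C, K, hC, h⟩ := d
  refine Tendsto.mono_left ?_ inf_le_left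
  set S := (volume : Measure (Sp N)).toSphere Set.univ with hS
  have hSfin : S ≠ ⊤ := measure_ne_top _ _
  have hlim : Tendsto (fun R : ℝ => R ^ N * (C * Real.exp (K * R - c * R ^ 2)) ^ 2) atTop (𝓝 0) := by
    have h1 : Tendsto (fun R : ℝ => R ^ N * Real.exp (-R)) atTop (𝓝 0) :=
      Real.tendsto_pow_mul_exp_neg_atTop_nhds_zero N
    have h2 := h1.const_mul (C ^ 2)
    rw [mul_zero] at h2
    refine tendsto_of_tendsto_of_tendsto_of_le_of_le' tendsto_const_nhds h2 ?_ ?_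
    · filter_upwards [eventually_ge_atTop 0] with R hR
      positivity
    -- Past this threshold `2(KR - cR²) ≤ -R`.
    · filter_upwards [eventually_ge_atTop 0, eventually_ge_atTop ((2 * K + 1) / (2 * c))]
        with R hR hR'
      have e : (C * Real.exp (K * R - c * R ^ 2)) ^ 2
          = C ^ 2 * Real.exp (2 * (K * R - c * R ^ 2)) := by
        rw [mul_pow, ← Real.exp_nat_mul]; norm_num
      rw [e, mul_left_comm]
      gcongr
      rw [div_le_iff₀ (by positivity)] at hR'
      nlinarith
  have hlim' : Tendsto (fun R : ℝ =>
      ENNReal.ofReal (R ^ N * (C * Real.exp (K * R - c * R ^ 2)) ^ 2) * S) atTop (𝓝 0) := by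
    have := ENNReal.Tendsto.mul_const (b := S) (ENNReal.tendsto_ofReal hlim) (Or.inr hSfin)
    simpa using this
  refine tendsto_of_tendsto_of_tendsto_of_le_of_le' tendsto_const_nhds hlim'
    (Eventually.of_forall fun _ => zero_le) ?_
  filter_upwards [eventually_ge_atTop 0] with R hR
  rw [ENNReal.ofReal_mul (by positivity), mul_assoc]
  gcongr
  rw [hS, ← lintegral_const]
  refine lintegral_mono fun s => enorm_sq_le_ofReal ?_
  have hs : ‖R • (s : Sp N)‖ = R := by
    rw [norm_smul, norm_eq_of_mem_sphere, mul_one, Real.norm_of_nonneg hR]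
  have := h (R • (s : Sp N))
  rw [hs] at this
  gcongr

/-! ### The extremal fields -/

theorem profile_apply (A : Matrix (Fin N) (Fin N) ℝ) (c : ℝ) (x : Sp N) (j : Fin N) :
    profile A c x j = (∑ k, A j k * x k) * gauss c x := rfl

theorem contDiff_profile (A : Matrix (Fin N) (Fin N) ℝ) (c : ℝ) : ContDiff ℝ ∞ (profile A c) := by
  rw [contDiff_piLp]
  intro j
  simp only [profile_apply]
  exact (ContDiff.sum fun k _ => contDiff_const.mul (contDiff_coord k)).mul (contDiff_gauss c)

theorem jac_profile (A : Matrix (Fin N) (Fin N) ℝ) (c : ℝ) (x : Sp N) (j k : Fin N) :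
    jac (profile A c) x j k = A j k * gauss c x - 2 * c * (x k * profile A c x j) := by
  rw [← fderiv_apply_eq_jac ((contDiff_profile A c).differentiable (by simp))]
  have e : (fun x => profile A c x j) = fun x => ∑ l, A j l * (x l * gauss c x) := by
    ext x
    simp only [profile_apply, Finset.sum_mul, mul_assoc]
  have hd (l : Fin N) : DifferentiableAt ℝ (fun x : Sp N => x l * gauss c x) x :=
    (contDiff_coord_mul_gauss c l).differentiable (by simp) x
  rw [e, fderiv_fun_sum fun l _ => (hd l).const_mul (A j l)]
  simp only [fun l => fderiv_const_mul (hd l) (A j l), sum_apply,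
    smul_apply, fderiv_coord_mul_gauss, smul_eq_mul, mul_sub,
    Finset.sum_sub_distrib, mul_ite, mul_zero, Finset.sum_ite_eq', Finset.mem_univ, if_true,
    profile_apply]
  congr 1
  rw [Finset.sum_mul, Finset.mul_sum, Finset.mul_sum]
  exact Finset.sum_congr rfl fun l _ => by ring

theorem norm_le_sum_abs (x : Sp N) : ‖x‖ ≤ ∑ j, |x j| := by
  have h := (EuclideanSpace.basisFun (Fin N) ℝ).sum_repr x
  nth_rewrite 1 [← h]
  refine (norm_sum_le _ _).trans (le_of_eq ?_)
  refine Finset.sum_congr rfl fun j _ => ?_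
  rw [norm_smul]
  simp

theorem gaussDecay_profile_apply (A : Matrix (Fin N) (Fin N) ℝ) (c : ℝ) (j : Fin N) :
    GaussDecay c fun x => profile A c x j := by
  simp only [profile_apply, Finset.sum_mul, mul_assoc]
  exact GaussDecay.sum _ fun k _ => ((gaussDecay_gauss c).coord_mul k).const_mul _

theorem gaussDecay_profile (A : Matrix (Fin N) (Fin N) ℝ) (c : ℝ) :
    GaussDecay c (profile A c) := by
  refine (GaussDecay.sum Finset.univ fun j _ => (gaussDecay_profile_apply A c j).norm).mono
    fun x => ?_
  rw [Real.norm_of_nonneg (Finset.sum_nonneg fun _ _ => norm_nonneg _)]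
  exact norm_le_sum_abs _

theorem gaussDecay_jac_profile (A : Matrix (Fin N) (Fin N) ℝ) (c : ℝ) (j k : Fin N) :
    GaussDecay c fun x => jac (profile A c) x j k := by
  simp only [jac_profile]
  have := ((gaussDecay_gauss c).const_mul (A j k)).add
    (((gaussDecay_profile_apply A c j).coord_mul k).const_mul (-(2 * c)))
  simpa only [sub_eq_add_neg, neg_mul] using this

theorem memD_profile (A : Matrix (Fin N) (Fin N) ℝ) {c : ℝ} (hc : 0 < c) :
    MemD (profile A c) (jac (profile A c)) :=
  memD_of_gaussDecay hc (contDiff_profile A c) (gaussDecay_profile A c)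
    (gaussDecay_jac_profile A c)

theorem sum_mul_profile (A : Matrix (Fin N) (Fin N) ℝ) (c : ℝ) (x : Sp N) :
    ∑ j, x j * profile A c x j = (x.ofLp ⬝ᵥ A *ᵥ x.ofLp) * gauss c x := by
  simp only [profile_apply, dotProduct, Matrix.mulVec, Finset.sum_mul, mul_assoc]

theorem dotProduct_mulVec_self_eq_zero {A : Matrix (Fin N) (Fin N) ℝ} (hA : Aᵀ = -A)
    (v : Fin N → ℝ) : v ⬝ᵥ A *ᵥ v = 0 := by
  have h : v ⬝ᵥ A *ᵥ v = -(v ⬝ᵥ A *ᵥ v) := by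
    conv_lhs => rw [Matrix.dotProduct_mulVec, ← Matrix.mulVec_transpose, hA, dotProduct_comm,
      Matrix.neg_mulVec, dotProduct_neg]
  linarith

/-- Polarisation: basis vectors give the diagonal, sums of two of them the symmetric part. -/
theorem transpose_eq_neg_of_dotProduct_mulVec_self {A : Matrix (Fin N) (Fin N) ℝ}
    (h : ∀ v : Fin N → ℝ, v ⬝ᵥ A *ᵥ v = 0) : Aᵀ = -A := by
  have hd (j : Fin N) : A j j = 0 := by simpa using h (Pi.single j 1)
  ext j k
  have := h (Pi.single j 1 + Pi.single k 1)
  simp [Matrix.mulVec_add, add_dotProduct, dotProduct_add, hd] at this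
  simp only [Matrix.transpose_apply, Matrix.neg_apply]
  linarith

theorem isToroidal_profile {A : Matrix (Fin N) (Fin N) ℝ} (hA : Aᵀ = -A) (c : ℝ) :
    IsToroidal (profile A c) (jac (profile A c)) := by
  have h0 (x : Sp N) : ∑ j, x j * profile A c x j = 0 := by
    rw [sum_mul_profile, dotProduct_mulVec_self_eq_zero hA, zero_mul]
  refine ⟨ae_of_all _ fun x => ?_, ae_of_all _ fun x => ?_⟩
  · rw [radial, real_inner_smul_left, PiLp.inner_apply]
    have := h0 x
    simp only [mul_comm (x _)] at this
    simp [this]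
  · have hd (j : Fin N) : A j j = 0 := by
      have := congrFun (congrFun hA j) j
      simp only [Matrix.transpose_apply, Matrix.neg_apply] at this
      linarith
    simp only [Matrix.trace, Matrix.diag_apply, jac_profile, hd, zero_mul, zero_sub,
      Finset.sum_neg_distrib, ← Finset.mul_sum, h0, mul_zero, neg_zero]

theorem profile_not_ae_eq_zero {A : Matrix (Fin N) (Fin N) ℝ} (hA : A ≠ 0) (c : ℝ) :
    ¬ profile A c =ᵐ[volume] 0 := by
  intro h
  have h0 : profile A c = 0 :=
    ((contDiff_profile A c).continuous.ae_eq_iff_eq volume continuous_zero).1 h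
  refine hA (Matrix.ext fun j k => ?_)
  have h1 : profile A c (EuclideanSpace.single k 1) j = 0 := by rw [h0]; rfl
  rw [profile_apply, mul_eq_zero] at h1
  simpa using h1.resolve_right (gauss_pos c _).ne'

theorem energy_profile {A : Matrix (Fin N) (Fin N) ℝ} {c : ℝ} (hc : 0 < c) :
    gradInt (jac (profile A c)) + 4 * c ^ 2 * momentInt (profile A c)
      = 2 * c * (N + 2) * massInt (profile A c) := by
  have h := memD_profile A hc
  have h1 := h.sum_integral_lower_sq c
  have h2 : ∑ j, ∑ k, ∫ x, (jac (profile A c) x j k + 2 * c * (x k * profile A c x j)) ^ 2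
      = 4 * c * massInt (profile A c) := by
    rw [h.massInt_eq, Finset.mul_sum]
    refine Finset.sum_congr rfl fun j _ => (h.sobD j).gap_eq_of_lower_eq hc (A j) ?_ ?_
    · exact fun x => profile_apply A c x j
    · exact fun k x => by rw [jac_profile]; ring
  linarith

/-- By `energy_profile` and `(g + 4c² M)² ≥ 16c² g M` the product is at most the bound; the
uncertainty inequality is the other half. -/
theorem uncertainty_eq_profile {A : Matrix (Fin N) (Fin N) ℝ} {c : ℝ} (hA : Aᵀ = -A)
    (hc : 0 < c) : gradInt (jac (profile A c)) * momentInt (profile A c)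
      = ((N : ℝ) + 2) ^ 2 / 4 * massInt (profile A c) ^ 2 := by
  have h1 := (memD_profile A hc).toroidal_uncertainty (isToroidal_profile hA c)
  have h2 := energy_profile (A := A) hc
  refine le_antisymm ?_ h1
  set g := gradInt (jac (profile A c))
  set M := momentInt (profile A c)
  set m := massInt (profile A c)
  have h3 : (g + 4 * c ^ 2 * M) ^ 2 = 16 * c ^ 2 * (((N : ℝ) + 2) ^ 2 / 4 * m ^ 2) := by
    rw [h2]; ring
  have h4 : 16 * c ^ 2 * (g * M) ≤ 16 * c ^ 2 * (((N : ℝ) + 2) ^ 2 / 4 * m ^ 2) := by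
    rw [← h3]
    nlinarith [sq_nonneg (g - 4 * c ^ 2 * M)]
  exact le_of_mul_le_mul_left h4 (by positivity)

theorem exists_antisymmetric_ne_zero (hN : 2 ≤ N) :
    ∃ A : Matrix (Fin N) (Fin N) ℝ, Aᵀ = -A ∧ A ≠ 0 := by
  let i : Fin N := ⟨0, by omega⟩
  let j : Fin N := ⟨1, by omega⟩
  have hij : i ≠ j := by simp [i, j]
  refine ⟨Matrix.single i j 1 - Matrix.single j i 1, ?_, fun h => ?_⟩
  · rw [Matrix.transpose_sub, Matrix.transpose_single, Matrix.transpose_single, neg_sub]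
  · have := congrFun (congrFun h i) j
    simp [hij, hij.symm] at this

/-- A toroidal field for which equality holds is one of the extremal fields. -/
theorem MemD.exists_profile_of_uncertainty_eq {u : Sp N → Sp N}
    {G : Sp N → Matrix (Fin N) (Fin N) ℝ} (h : MemD u G) (ht : IsToroidal u G)
    (hu : ¬ u =ᵐ[volume] 0)
    (heq : gradInt G * momentInt u = ((N : ℝ) + 2) ^ 2 / 4 * massInt u ^ 2) :
    ∃ (A : Matrix (Fin N) (Fin N) ℝ) (c : ℝ), Aᵀ = -A ∧ 0 < c ∧ u =ᵐ[volume] profile A c := by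
  have hm := h.massInt_pos hu
  have hprod : 0 < gradInt G * momentInt u := by rw [heq]; positivity
  have hM : 0 < momentInt u := pos_of_mul_pos_right hprod (gradInt_nonneg G)
  have hg : 0 < gradInt G := pos_of_mul_pos_left hprod hM.le
  -- Chosen so that `4b² M = g`, the equality case of the arithmetic-geometric mean inequality; then
  -- equality of products becomes equality of energies.
  set b := Real.sqrt (gradInt G / momentInt u) / 2 with hbdef
  have hb : 0 < b := by positivity
  have hb2 : 4 * b ^ 2 * momentInt u = gradInt G := by
    rw [hbdef, div_pow, Real.sq_sqrt (by positivity)]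
    field_simp
    norm_num
  have hE : gradInt G + 4 * b ^ 2 * momentInt u = 2 * b * (N + 2) * massInt u := by
    have hsq : (gradInt G + 4 * b ^ 2 * momentInt u) ^ 2 = (2 * b * (N + 2) * massInt u) ^ 2 := by
      calc (gradInt G + 4 * b ^ 2 * momentInt u) ^ 2
          = 4 * gradInt G * (4 * b ^ 2 * momentInt u) := by rw [hb2]; ring
        _ = 16 * b ^ 2 * (gradInt G * momentInt u) := by ring
        _ = _ := by rw [heq]; ring
    exact (pow_left_inj₀ (by positivity) (by positivity) two_ne_zero).1 hsq
  have hgap (j : Fin N) := (h.sobD j).gap hb (integral_apply_mul_gauss_eq_zero h ht hb j)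
  have hsum : ∑ j, 4 * b * (∫ x, u x j ^ 2)
      = ∑ j, ∑ k, ∫ x, (G x j k + 2 * b * (x k * u x j)) ^ 2 := by
    rw [h.sum_integral_lower_sq, ← Finset.mul_sum, ← h.massInt_eq]
    linarith
  -- Termwise inequalities with equal sums are all equalities, so every component attains the gap.
  have hj := (Finset.sum_eq_sum_iff_of_le fun j _ => hgap j).1 hsum
  choose a ha using fun j => (h.sobD j).eq_linear_mul_gauss hb
    (integral_apply_mul_gauss_eq_zero h ht hb j) (hj j (Finset.mem_univ j)).symm
  let A : Matrix (Fin N) (Fin N) ℝ := Matrix.of a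
  have hae : u =ᵐ[volume] profile A b := by
    filter_upwards [ae_all_iff.2 ha] with x hx
    ext j
    exact hx j
  refine ⟨A, b, ?_, hb, hae⟩
  refine transpose_eq_neg_of_dotProduct_mulVec_self fun v => ?_
  have hq : (fun x : Sp N => ∑ j, x j * profile A b x j) =ᵐ[volume] fun _ => 0 := by
    filter_upwards [ht.1, hae] with x hx hx'
    rw [← hx']
    exact inner_eq_zero_of_radial_eq_zero hx
  have hcont : Continuous fun x : Sp N => ∑ j, x j * profile A b x j :=
    continuous_finsetSum _ fun j _ => (contDiff_coord j).continuous.mul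
      (contDiff_apply_of_contDiff (contDiff_profile A b) j).continuous
  -- Continuity upgrades `x · u = 0` from almost every point to every point, so the quadratic form
  -- of `A` vanishes identically.
  have hz := congrFun ((hcont.ae_eq_iff_eq volume continuous_const).1 hq) (WithLp.toLp 2 v)
  beta_reduce at hz
  rw [sum_mul_profile, mul_eq_zero] at hz
  exact hz.resolve_right (gauss_pos b _).ne'

end HUP

end

/-! ### Inequality, attained minimum, extremal fields and their uniqueness. -/

theorem theorem2 (N : ℕ) (hN : 2 ≤ N) :
    (∀ (u : HUP.Sp N → HUP.Sp N) (G : HUP.Sp N → Matrix (Fin N) (Fin N) ℝ),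
      HUP.MemD u G → HUP.IsToroidal u G →
        HUP.gradInt G * HUP.momentInt u ≥ ((N : ℝ) + 2) ^ 2 / 4 * HUP.massInt u ^ 2) ∧
    IsLeast {Q : ℝ | ∃ (u : HUP.Sp N → HUP.Sp N) (G : HUP.Sp N → Matrix (Fin N) (Fin N) ℝ),
      HUP.MemD u G ∧ HUP.IsToroidal u G ∧ ¬ (u =ᵐ[volume] 0) ∧
        Q = HUP.gradInt G * HUP.momentInt u / HUP.massInt u ^ 2} (((N : ℝ) + 2) ^ 2 / 4) ∧
    (∀ (A : Matrix (Fin N) (Fin N) ℝ) (c : ℝ), Aᵀ = -A → 0 < c →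
      ContDiff ℝ ∞ (HUP.profile A c) ∧
      HUP.MemD (HUP.profile A c) (HUP.jac (HUP.profile A c)) ∧
      HUP.IsToroidal (HUP.profile A c) (HUP.jac (HUP.profile A c)) ∧
      HUP.DecayCond (HUP.profile A c) ∧
      (A ≠ 0 → ¬ (HUP.profile A c =ᵐ[volume] 0)) ∧
      HUP.gradInt (HUP.jac (HUP.profile A c)) * HUP.momentInt (HUP.profile A c)
        = ((N : ℝ) + 2) ^ 2 / 4 * HUP.massInt (HUP.profile A c) ^ 2) ∧
    (∀ (u : HUP.Sp N → HUP.Sp N) (G : HUP.Sp N → Matrix (Fin N) (Fin N) ℝ),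
      HUP.MemD u G → HUP.IsToroidal u G → HUP.DecayCond u → ¬ (u =ᵐ[volume] 0) →
      HUP.gradInt G * HUP.momentInt u = ((N : ℝ) + 2) ^ 2 / 4 * HUP.massInt u ^ 2 →
        ∃ (A : Matrix (Fin N) (Fin N) ℝ) (c : ℝ), Aᵀ = -A ∧ 0 < c ∧
          u =ᵐ[volume] HUP.profile A c) := by
  refine ⟨fun u G h ht => h.toroidal_uncertainty ht, ⟨?_, ?_⟩, fun A c hA hc =>
    ⟨HUP.contDiff_profile A c, HUP.memD_profile A hc, HUP.isToroidal_profile hA c,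
      HUP.decayCond_of_gaussDecay hc (HUP.gaussDecay_profile A c),
      fun h => HUP.profile_not_ae_eq_zero h c, HUP.uncertainty_eq_profile hA hc⟩,
    fun u G h ht _ hu heq => h.exists_profile_of_uncertainty_eq ht hu heq⟩
  -- The minimum is attained at any nonzero extremal field; nonzero antisymmetric matrices exist
  -- because `N ≥ 2`.
  · obtain ⟨A, hA, hA0⟩ := HUP.exists_antisymmetric_ne_zero hN
    have h := HUP.memD_profile A one_pos
    have hne := HUP.profile_not_ae_eq_zero hA0 1
    refine ⟨_, _, h, HUP.isToroidal_profile hA 1, hne, ?_⟩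
    rw [HUP.uncertainty_eq_profile hA one_pos,
      mul_div_cancel_right₀ _ (pow_pos (h.massInt_pos hne) 2).ne']
  · rintro Q ⟨u, G, h, ht, hu, rfl⟩
    rw [le_div_iff₀ (pow_pos (h.massInt_pos hu) 2)]
    exact h.toroidal_uncertainty ht
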